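/- Let $L$ be a first-order language with equality, with arbitrary sets of function symbols (constants are $0$-ary function symbols) and predicate symbols, and a denumerable set of variables. A (positive conjunctive) query over $L$ is a formula built from $\mathrm{True}$, $\mathrm{False}$, equations $s=t$ and atoms $p(t_1,\dots,t_n)$ by $\wedge$ and $\exists$. Conjunctions are written without brackets, i.e. queries are considered up to the associativity of $\wedge$. $|Q|$ denotes the number of atoms of $Q$. **Solved form.** $Q$ is in solved form if it is $\mathrm{True}$ or $\mathrm{False}$ or of the form $(\exists z_1)\dots(\exists z_k)(x_1=s_1\wedge\dots\wedge x_n=s_n\wedge A_1\wedge\dots\wedge A_m)$ with atoms $A_j$, where the $x_i$ and $z_j$ are distinct variables, no $x_i$ occurs in any $s_j$ or $A_j$, each $z_j$ occurs in the conjunction, and no $s_i$ is one of the variables $z_j$. **Algorithm.** Starting from a query, apply nondeterministically any of the following steps, until $\mathrm{False}$ has been returned or no step applies. Steps (1)–(4) replace an equation occurring anywhere in the query: (1) $f(s_1,\dots,s_n)=f(t_1,\dots,t_n)$ by $s_1=t_1\wedge\dots\wedge s_n=t_n$ (by $\mathrm{True}$ if $n=0$); (2) $f(\dots)=g(\dots)$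 by $\mathrm{False}$ if $f\neq g$; (3) $x=t$ by $\mathrm{False}$ if $t\neq x$ and $x$ occurs in $t$; (4) $x=x$ by $\mathrm{True}$. Steps (5)–(7) act on a subquery $(\exists\bar y)(Q'\wedge e\wedge Q'')$, where $Q',Q''$ are (possibly empty) conjunctions of equations and atoms only, $\bar y$ is a possibly empty sequence, and $Q'\wedge e\wedge Q''$ is not a proper part of a longer conjunction: (5) if $e$ is $x=t$, $x$ is not in $t$ and not in $\bar y$, and $x$ occurs in $Q'$ or $Q''$: substitute $t$ for $x$ in $Q'$ and $Q''$; (6) if $e$ is $x=t$, $x$ is not in $t$, and $x$ is in $\bar y$: substitute $t$ for $x$ in $Q'$ and $Q''$ and replace $e$ by $\mathrm{True}$; (7) if $e$ is $t=x$ and either $t$ is not a variable, or $t$ is a variable distinct from $x$ and not in $\bar y$ while $x$ is in $\bar y$: replace $e$ by $x=t$. The other steps are: (8) replace a subquery $(\exists\bar y')(\exists y)(\exists\bar y'')R$ by $(\exists\bar y')(\exists\bar y'')R$ if $y$ is not free in $(\exists\bar y'')R$; (9) replace a subquery $(\exists\bar y_1)Q_1\wedge(\exists\bar y_2)Q_2$,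 where $\bar y_1,\bar y_2$ are not both empty, by $(\exists\bar z_1)(\exists\bar z_2)(R_1\wedge R_2)$, where $(\exists\bar z_i)R_i$ is a variant (renaming of bound variables) of $(\exists\bar y_i)Q_i$, with $\bar z_i$ of the same length as $\bar y_i$, no variable of $\bar z_2$ is free in $R_1$, and no variable of $\bar z_1$ is free in $R_2$; (10) replace $A\wedge s=t$ by $s=t\wedge A$ for an atom $A$; (11) delete a conjunct $\mathrm{True}$; (12) replace the whole query by $\mathrm{False}$ if $\mathrm{False}$ occurs in it. **Equivalence.** A pre-interpretation $J$ is a non-empty domain $D$ with an interpretation of the function symbols. It is a model of the free equality axioms if every $f$ is interpreted by an injective function, distinct function symbols are interpreted by functions with disjoint ranges, and $h(x)\neq h(t)$ for every valuation $h$ whenever $x$ occurs in a term $t\neq x$. A multiinterpretation for $Q$ based on $J$ is a sequence $\bar I$ of $|Q|$ interpretations of the predicate symbols in $D$. A valuation is a solution of $Q$ in $\bar I$ if it satisfies $Q$ when, for each $i$, the $i$-th atom occurrence of $Q$ (from left to right) is read in the $i$-th interpretation of $\bar I$. Queries $Q,Q'$ are equivalent, $Q\approx Q'$, if $|Q|=|Q'|$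 and, for every model $J$ of the free equality axioms, $Q$ and $Q'$ have the same solutions in every multiinterpretation of length $|Q|$ based on $J$. **Theorem.** Let $Q$ be a query. There is no infinite run of the algorithm on $Q$, and the algorithm has an output on $Q$. Every output $Q'$ of the algorithm on $Q$ is in solved form, and: (a) if $Q'$ is not $\mathrm{False}$, or if $|Q|=0$, then $Q\approx Q'$; in particular $|Q'|=|Q|$; (b) if $Q'$ is $\mathrm{False}$, then $Q$ has no solution in any multiinterpretation for $Q$ based on any model of the free equality axioms; (c) in every case $Q\leftrightarrow Q'$ is a logical consequence of the free equality axioms. -/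

import Mathlib

universe u v w

namespace ConjQuery



/-- Positive conjunctive queries over the language `L`; the variables are the natural numbers.
Equality is a logical symbol, `L.Relations` are the other predicate symbols. -/
inductive Query (L : FirstOrder.Language.{u, v}) : Type (max u v)
  | tt : Query L
  | ff : Query L
  | eq (s t : L.Term ℕ) : Query L
  | atom {n : ℕ} (p : L.Relations n) (ts : Fin n → L.Term ℕ) : Query L
  | and (Q₁ Q₂ : Query L) : Query L
  | ex (x : ℕ) (Q : Query L) : Query L

section Syntactic

variable {L : FirstOrder.Language.{u, v}}

/-- The term obtained from `s` by replacing every occurrence of `x` by `t`. -/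
def substTerm (x : ℕ) (t s : L.Term ℕ) : L.Term ℕ :=
  s.subst (fun y => if y = x then t else FirstOrder.Language.Term.var y)

namespace Query

/-- The number of atoms occurring in a query. -/
def card : Query L → ℕ
  | tt => 0
  | ff => 0
  | eq _ _ => 0
  | atom _ _ => 1
  | and Q₁ Q₂ => Q₁.card + Q₂.card
  | ex _ Q => Q.card

/-- The set of free variables. -/
def freeVars : Query L → Finset ℕ
  | tt => ∅
  | ff => ∅
  | eq s t => s.varFinset ∪ t.varFinset
  | atom _ ts => Finset.univ.biUnion (fun i => (ts i).varFinset)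
  | and Q₁ Q₂ => Q₁.freeVars ∪ Q₂.freeVars
  | ex x Q => Q.freeVars.erase x

/-- Replacement of all free occurrences of `x` by `t`. -/
def subst (x : ℕ) (t : L.Term ℕ) : Query L → Query L
  | tt => tt
  | ff => ff
  | eq s₁ s₂ => eq (substTerm x t s₁) (substTerm x t s₂)
  | atom p ts => atom p (fun i => substTerm x t (ts i))
  | and Q₁ Q₂ => and (Q₁.subst x t) (Q₂.subst x t)
  | ex y Q => if y = x then ex y Q else ex y (Q.subst x t)

/-- `t` is substitutible for `x`: no free occurrence of `x` is in the scope of a quantifier that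
binds a variable of `t`. -/
def Substitutible (x : ℕ) (t : L.Term ℕ) : Query L → Prop
  | tt => True
  | ff => True
  | eq _ _ => True
  | atom _ _ => True
  | and Q₁ Q₂ => Q₁.Substitutible x t ∧ Q₂.Substitutible x t
  | ex y Q => x ∉ (ex y Q).freeVars ∨ (y ∉ t.varFinset ∧ Q.Substitutible x t)

/-- The propositional constant `ff` occurs in the query. -/
def HasFF : Query L → Prop
  | tt => False
  | ff => True
  | eq _ _ => False
  | atom _ _ => False
  | and Q₁ Q₂ => Q₁.HasFF ∨ Q₂.HasFF
  | ex _ Q => Q.HasFF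

def IsEquation (Q : Query L) : Prop := ∃ s t, Q = eq s t

def IsAtom (Q : Query L) : Prop :=
  ∃ (n : ℕ) (p : L.Relations n) (ts : Fin n → L.Term ℕ), Q = atom p ts

/-- The conjunction of a list of queries; the empty conjunction is `tt`. -/
def conj : List (Query L) → Query L
  | [] => tt
  | [Q] => Q
  | Q :: Q' :: Qs => and Q (conj (Q' :: Qs))

/-- The query `(∃ y₁) … (∃ yₖ) Q`. -/
def exs (ys : List ℕ) (Q : Query L) : Query L := ys.foldr ex Q

end Query

open Query

/-- `Everywhere r Q Q'`: one subquery `P` of `Q` is replaced by some `P'` with `r P P'`. -/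
inductive Everywhere (r : Query L → Query L → Prop) : Query L → Query L → Prop
  | here {P P' : Query L} : r P P' → Everywhere r P P'
  | andLeft {P P' : Query L} (R : Query L) :
      Everywhere r P P' → Everywhere r (and P R) (and P' R)
  | andRight {P P' : Query L} (R : Query L) :
      Everywhere r P P' → Everywhere r (and R P) (and R P')
  | ex {P P' : Query L} (x : ℕ) : Everywhere r P P' → Everywhere r (ex x P) (ex x P')

inductive AssocRule : Query L → Query L → Prop
  | assoc (P Q R : Query L) : AssocRule (and (and P Q) R) (and P (and Q R))

/-- The two queries differ only in the bracketing of their conjunctions. -/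
def AssocEq : Query L → Query L → Prop := Relation.EqvGen (Everywhere AssocRule)

inductive RenameRule : Query L → Query L → Prop
  | rename (x y : ℕ) (G : Query L) : y ∉ G.freeVars →
      G.Substitutible x (FirstOrder.Language.Term.var y) →
      RenameRule (ex x G) (ex y (G.subst x (FirstOrder.Language.Term.var y)))

/-- `Variant F F'`: `F'` is obtained from `F` by finitely many renamings of bound variables. -/
def Variant : Query L → Query L → Prop := Relation.ReflTransGen (Everywhere RenameRule)

/-- Steps (1)-(4) and (8)-(11), which act on an arbitrary subquery. -/
inductive LocalRule : Query L → Query L → Prop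
  | r1 {n : ℕ} (f : L.Functions n) (s t : Fin n → L.Term ℕ) :
      LocalRule (eq (FirstOrder.Language.Term.func f s) (FirstOrder.Language.Term.func f t))
        (conj (List.ofFn fun i => eq (s i) (t i)))
  | r2 {n m : ℕ} (f : L.Functions n) (g : L.Functions m)
      (s : Fin n → L.Term ℕ) (t : Fin m → L.Term ℕ) :
      (⟨n, f⟩ : Σ k, L.Functions k) ≠ ⟨m, g⟩ →
      LocalRule (eq (FirstOrder.Language.Term.func f s) (FirstOrder.Language.Term.func g t)) ff
  | r3 (x : ℕ) (t : L.Term ℕ) : t ≠ FirstOrder.Language.Term.var x → x ∈ t.varFinset →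
      LocalRule (eq (FirstOrder.Language.Term.var x) t) ff
  | r4 (x : ℕ) : LocalRule (eq (FirstOrder.Language.Term.var x) (FirstOrder.Language.Term.var x)) tt
  | r8 (ys zs : List ℕ) (y : ℕ) (Q : Query L) : y ∉ (exs zs Q).freeVars →
      LocalRule (exs (ys ++ y :: zs) Q) (exs (ys ++ zs) Q)
  | r9 (ys₁ ys₂ zs₁ zs₂ : List ℕ) (Q₁ Q₂ R₁ R₂ : Query L) :
      (ys₁ ≠ [] ∨ ys₂ ≠ []) →
      zs₁.length = ys₁.length → zs₂.length = ys₂.length →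
      Variant (exs ys₁ Q₁) (exs zs₁ R₁) → Variant (exs ys₂ Q₂) (exs zs₂ R₂) →
      (∀ z ∈ zs₂, z ∉ R₁.freeVars) → (∀ z ∈ zs₁, z ∉ R₂.freeVars) →
      LocalRule (and (exs ys₁ Q₁) (exs ys₂ Q₂)) (exs zs₁ (exs zs₂ (and R₁ R₂)))
  | r10 (A : Query L) (s t : L.Term ℕ) : A.IsAtom →
      LocalRule (and A (eq s t)) (and (eq s t) A)
  | r11_left (Q : Query L) : LocalRule (and tt Q) Q
  | r11_right (Q : Query L) : LocalRule (and Q tt) Q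

/-- Steps (5)-(7). `BlockRule ys B B'` means that `(∃ ys) B` is replaced by `(∃ ys) B'`, where `B`
is a conjunction of equations and atoms only. -/
inductive BlockRule : List ℕ → Query L → Query L → Prop
  | r5 (ys : List ℕ) (Q₁ Q₂ : List (Query L)) (x : ℕ) (t : L.Term ℕ) :
      (∀ A ∈ Q₁ ++ Q₂, A.IsEquation ∨ A.IsAtom) →
      x ∉ t.varFinset → x ∉ ys → (∃ A ∈ Q₁ ++ Q₂, x ∈ A.freeVars) →
      BlockRule ys (conj (Q₁ ++ eq (FirstOrder.Language.Term.var x) t :: Q₂))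
        (conj (Q₁.map (subst x t) ++ eq (FirstOrder.Language.Term.var x) t :: Q₂.map (subst x t)))
  | r6 (ys : List ℕ) (Q₁ Q₂ : List (Query L)) (x : ℕ) (t : L.Term ℕ) :
      (∀ A ∈ Q₁ ++ Q₂, A.IsEquation ∨ A.IsAtom) →
      x ∉ t.varFinset → x ∈ ys →
      BlockRule ys (conj (Q₁ ++ eq (FirstOrder.Language.Term.var x) t :: Q₂))
        (conj (Q₁.map (subst x t) ++ tt :: Q₂.map (subst x t)))
  | r7 (ys : List ℕ) (Q₁ Q₂ : List (Query L)) (x : ℕ) (t : L.Term ℕ) :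
      (∀ A ∈ Q₁ ++ Q₂, A.IsEquation ∨ A.IsAtom) →
      ((∀ z, t ≠ FirstOrder.Language.Term.var z) ∨
        (∃ z, t = FirstOrder.Language.Term.var z ∧ z ≠ x ∧ z ∉ ys ∧ x ∈ ys)) →
      BlockRule ys (conj (Q₁ ++ eq t (FirstOrder.Language.Term.var x) :: Q₂))
        (conj (Q₁ ++ eq (FirstOrder.Language.Term.var x) t :: Q₂))

/-- A step (5)-(7) inside a query with quantifier prefix `ws`; the subquery `(∃ ys) B` that is
rewritten may use any final segment `ys` of the prefix `ws = xs ++ ys`. -/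
inductive BlockStep : List ℕ → Query L → Query L → Prop
  | intro (xs ys : List ℕ) (B B' : Query L) : BlockRule ys B B' →
      BlockStep (xs ++ ys) (exs (xs ++ ys) B) (exs (xs ++ ys) B')

/-- One of the steps (1)-(12), for fixed bracketing. The conjunction rewritten by (5)-(7) is never
a proper part of a longer conjunction: it is the whole query or stands directly under a
quantifier. -/
inductive Elementary : Query L → Query L → Prop
  | anywhere {Q Q' : Query L} : Everywhere LocalRule Q Q' → Elementary Q Q'
  | wholeBlock {Q Q' : Query L} (ws : List ℕ) : BlockStep ws Q Q' → Elementary Q Q'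
  | innerBlock {Q Q' : Query L} :
      Everywhere (fun P P' => ∃ ws, ws ≠ [] ∧ BlockStep ws P P') Q Q' → Elementary Q Q'
  | r12 (Q : Query L) : Q.HasFF → Elementary Q ff

/-- One step of the algorithm. Conjunctions are unbracketed, so steps are taken up to bracketing;
the algorithm stops as soon as `ff` has been returned. -/
def Step (Q Q' : Query L) : Prop :=
  Q ≠ ff ∧ ∃ P P', AssocEq Q P ∧ Elementary P P' ∧ AssocEq P' Q'

/-- `Q'` is an output of a run of the algorithm on the input `Q`. -/
def Output (Q Q' : Query L) : Prop :=
  Relation.ReflTransGen Step Q Q' ∧ (Q' = ff ∨ ¬ ∃ R, Step Q' R)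

/-- Solved form: `tt`, `ff`, or `(∃ z₁) … (∃ zₖ) (x₁ = s₁ ∧ … ∧ xₙ = sₙ ∧ A₁ ∧ … ∧ Aₘ)` with the
four usual conditions. -/
def InSolvedForm (Q : Query L) : Prop :=
  Q = tt ∨ Q = ff ∨
    ∃ (zs : List ℕ) (eqs : List (ℕ × L.Term ℕ)) (atoms : List (Query L)) (body : Query L),
      body = conj (eqs.map (fun e => eq (FirstOrder.Language.Term.var e.1) e.2) ++ atoms) ∧
      AssocEq Q (exs zs body) ∧
      (∀ A ∈ atoms, A.IsAtom) ∧
      (eqs.map Prod.fst ++ zs).Nodup ∧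
      (∀ x ∈ eqs.map Prod.fst,
        (∀ e ∈ eqs, x ∉ e.2.varFinset) ∧ (∀ A ∈ atoms, x ∉ A.freeVars)) ∧
      (∀ z ∈ zs, z ∈ body.freeVars) ∧
      (∀ z ∈ zs, ∀ e ∈ eqs, e.2 ≠ FirstOrder.Language.Term.var z)

end Syntactic

/-- An interpretation of all function symbols in the domain `D`. -/
abbrev PreInterp (L : FirstOrder.Language.{u, v}) (D : Type w) : Type (max u w) :=
  ∀ n : ℕ, L.Functions n → (Fin n → D) → D

/-- An interpretation of all predicate symbols in the domain `D`. -/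
abbrev Interp (L : FirstOrder.Language.{u, v}) (D : Type w) : Type (max v w) :=
  ∀ n : ℕ, L.Relations n → (Fin n → D) → Prop

section Semantic

variable {L : FirstOrder.Language.{u, v}} {D : Type w}

/-- The value of a term under the valuation `h`. -/
def eval (J : PreInterp L D) (h : ℕ → D) : L.Term ℕ → D
  | .var x => h x
  | .func f ts => J _ f (fun i => eval J h (ts i))

/-- `J` is a model of the free equality axioms. -/
structure IsFEAModel (J : PreInterp L D) : Prop where
  injective : ∀ (n : ℕ) (f : L.Functions n) (a b : Fin n → D),
    J n f a = J n f b ↔ ∀ i, a i = b i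
  disjoint : ∀ (n m : ℕ) (f : L.Functions n) (g : L.Functions m) (a : Fin n → D) (b : Fin m → D),
    (⟨n, f⟩ : Σ k, L.Functions k) ≠ ⟨m, g⟩ → J n f a ≠ J m g b
  acyclic : ∀ (h : ℕ → D) (x : ℕ) (t : L.Term ℕ),
    t ≠ FirstOrder.Language.Term.var x → x ∈ t.varFinset → h x ≠ eval J h t

/-- Truth of a query in a single interpretation, under the valuation `h`. -/
def Holds (J : PreInterp L D) (I : Interp L D) (h : ℕ → D) : Query L → Prop
  | .tt => True
  | .ff => False
  | .eq s t => eval J h s = eval J h t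
  | .atom p ts => I _ p (fun i => eval J h (ts i))
  | .and Q₁ Q₂ => Holds J I h Q₁ ∧ Holds J I h Q₂
  | .ex x Q => ∃ d, Holds J I (Function.update h x d) Q

/-- The solutions of a query in a multiinterpretation `Is`, a list of interpretations of length
`Q.card`: the `i`-th atom of `Q` is read in the `i`-th interpretation. -/
def solutions (J : PreInterp L D) : Query L → List (Interp L D) → Set (ℕ → D)
  | .tt, _ => Set.univ
  | .ff, _ => ∅
  | .eq s t, _ => {h | eval J h s = eval J h t}
  | .atom p ts, Is => {h | ∃ I ∈ Is.head?, I _ p (fun i => eval J h (ts i))}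
  | .and Q₁ Q₂, Is => solutions J Q₁ (Is.take Q₁.card) ∩ solutions J Q₂ (Is.drop Q₁.card)
  | .ex x Q, Is => {h | ∃ d, Function.update h x d ∈ solutions J Q Is}

/-- The relation `Q ≼_J Q'`. -/
def LeJ (J : PreInterp L D) (Q Q' : Query L) : Prop :=
  Q.card = Q'.card ∧
    ∀ Is : List (Interp L D), Is.length = Q.card → solutions J Q Is ⊆ solutions J Q' Is

end Semantic

section Equivalence

variable {L : FirstOrder.Language.{u, v}}

/-- `Q'` is more general than `Q`. The cardinality condition of `LeJ` is repeated, so that it does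
not depend on the existence of models. -/
def Le (Q Q' : Query L) : Prop :=
  Q.card = Q'.card ∧
    ∀ (D : Type w) [Nonempty D] (J : PreInterp L D), IsFEAModel J → LeJ J Q Q'

/-- Equivalence of queries in the multiinterpretation sense. -/
def Equivalent (Q Q' : Query L) : Prop := Le.{u, v, w} Q Q' ∧ Le.{u, v, w} Q' Q

/-- `Q` has no solution in any multiinterpretation for it over a model of the free equality
axioms. -/
def Unsolvable (Q : Query L) : Prop :=
  ∀ (D : Type w) [Nonempty D] (J : PreInterp L D), IsFEAModel J →
    ∀ Is : List (Interp L D), Is.length = Q.card → solutions J Q Is = ∅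

/-- `Q ↔ Q'` is a logical consequence of the free equality axioms. -/
def FEAEquivalent (Q Q' : Query L) : Prop :=
  ∀ (D : Type w) [Nonempty D] (J : PreInterp L D), IsFEAModel J →
    ∀ (I : Interp L D) (h : ℕ → D), Holds J I h Q ↔ Holds J I h Q'

end Equivalence

end ConjQuery

namespace ConjQuery

open FirstOrder.Language (Term)

variable {L : FirstOrder.Language.{u, v}}

/-! ### Terms, substitution and free variables -/

/-! Soundness. Every step except `r12` preserves the number of atoms and the solutions in every
multiinterpretation over a model of the free equality axioms (`SolEquiv`). Injectivity, disjointness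
and acyclicity justify `r1`, `r2` and `r3`; the block steps rest on the fact that replacing x by t
changes nothing at valuations giving x and t the same value. Step `r12` may lose atoms, but it needs
an unsolvable query and returns `ff`, after which nothing happens. So an output is either `SolEquiv`
to the input, or it is `ff` and the input is unsolvable (`solEquiv_or_of_reachable`). Reading all
atoms in one interpretation turns this into logical equivalence.

Termination. Substitution enlarges terms, and prenexing merges blocks, so no simple size decreases.
The lexicographic measure `rank` starts with quantities insensitive to term growth inside blocks:
the number of quantifiers (`r8`), then the parallel pairs of quantifiers and the crossings of open
leaves with quantifiers (`r9`). Next comes, summed over blocks, the number of variables minus the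
number of solved equations. Steps `r5` and `r6` lower it, unless the equation used was already
solved; then either x occurs nowhere else or t is a variable, so the other leaves keep their
weights. The total leaf weight is next (`r1` to `r4`, `r11_left`, `r11_right`, the rest of `r6`, and
`r7` with a non-variable left side).

What remains is variable equations. If z occurs only in x = z, step `r5` merely exchanges the roles
of x and z, and `r7` may reverse the equation. `stateWeight` gives state 1 to a variable occurring
in several leaves; one occurring in a single leaf gets 3 if that leaf equates it, on the left, with
a deeper variable, otherwise 2 if it is the right side of an equation with another variable,
otherwise 0. Deeper variables dominate. This drops under the exchange (`stateWeight_subst_var`) and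
does not rise under a reversal, which lowers `misoriented`. Last come the inversions (`r10`).

Solved form. Each failing condition enables a step: the contrapositive is
`inSolvedForm_of_terminal`. -/

theorem mem_varFinset_func {n : ℕ} {f : L.Functions n} {ts : Fin n → L.Term ℕ} {v : ℕ} :
    v ∈ (Term.func f ts).varFinset ↔ ∃ i, v ∈ (ts i).varFinset := by
  simp [Term.varFinset]

theorem substTerm_var (x : ℕ) (t : L.Term ℕ) (y : ℕ) :
    substTerm x t (Term.var y) = if y = x then t else Term.var y := rfl

theorem substTerm_func (x : ℕ) (t : L.Term ℕ) {n : ℕ} (f : L.Functions n)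
    (ts : Fin n → L.Term ℕ) :
    substTerm x t (Term.func f ts) = Term.func f (fun i => substTerm x t (ts i)) := rfl

theorem mem_varFinset_substTerm {x v : ℕ} {t s : L.Term ℕ} :
    v ∈ (substTerm x t s).varFinset ↔
      (v ≠ x ∧ v ∈ s.varFinset) ∨ (x ∈ s.varFinset ∧ v ∈ t.varFinset) := by
  induction s with
  | var y =>
    rw [substTerm_var]
    split_ifs with h
    · subst h
      simp [Term.varFinset]
    · have h' : x ≠ y := fun e => h e.symm
      simp only [Term.varFinset, Finset.mem_singleton, h', false_and, or_false]
      exact ⟨fun e => ⟨fun e' => h (e ▸ e'), e⟩, fun e => e.2⟩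
  | func f ts ih =>
    rw [substTerm_func]
    simp only [mem_varFinset_func, ih]
    constructor
    · rintro ⟨i, h | h⟩
      · exact Or.inl ⟨h.1, i, h.2⟩
      · exact Or.inr ⟨⟨i, h.1⟩, h.2⟩
    · rintro (⟨h, i, hi⟩ | ⟨⟨i, hi⟩, h⟩)
      · exact ⟨i, Or.inl ⟨h, hi⟩⟩
      · exact ⟨i, Or.inr ⟨hi, h⟩⟩

theorem substTerm_of_notMem {x : ℕ} {t s : L.Term ℕ} (h : x ∉ s.varFinset) :
    substTerm x t s = s := by
  induction s with
  | var y =>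
    have : y ≠ x := fun e => h (by simp [Term.varFinset, e])
    simp [substTerm_var, this]
  | func f ts ih =>
    rw [substTerm_func]
    congr 1
    funext i
    exact ih i (fun hi => h (mem_varFinset_func.2 ⟨i, hi⟩))

namespace Query

theorem mem_freeVars_atom {n : ℕ} {p : L.Relations n} {ts : Fin n → L.Term ℕ} {v : ℕ} :
    v ∈ (atom p ts).freeVars ↔ ∃ i, v ∈ (ts i).varFinset := by
  simp [freeVars]

theorem subst_of_notMem {x : ℕ} {t : L.Term ℕ} {Q : Query L} (h : x ∉ Q.freeVars) :
    Q.subst x t = Q := by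
  induction Q with
  | tt => rfl
  | ff => rfl
  | eq s₁ s₂ =>
    simp only [freeVars, Finset.mem_union, not_or] at h
    simp [subst, substTerm_of_notMem h.1, substTerm_of_notMem h.2]
  | atom p ts =>
    simp only [subst]
    congr 1
    funext i
    exact substTerm_of_notMem (fun hi => h (mem_freeVars_atom.2 ⟨i, hi⟩))
  | and P R ihP ihR =>
    simp only [freeVars, Finset.mem_union, not_or] at h
    simp [subst, ihP h.1, ihR h.2]
  | ex y P ih =>
    simp only [subst]
    split_ifs with e
    · rfl
    · rw [ih]
      intro hx
      exact h (by simp [freeVars, hx, Ne.symm e])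

theorem card_subst (x : ℕ) (t : L.Term ℕ) (Q : Query L) : (Q.subst x t).card = Q.card := by
  induction Q with
  | and P R ihP ihR => simp [subst, card, ihP, ihR]
  | ex y P ih =>
    simp only [subst]
    split_ifs <;> simp [card, ih]
  | _ => rfl

theorem card_exs (ys : List ℕ) (Q : Query L) : (exs ys Q).card = Q.card := by
  induction ys with
  | nil => rfl
  | cons y ys ih => exact ih

theorem exs_append (ys zs : List ℕ) (Q : Query L) : exs (ys ++ zs) Q = exs ys (exs zs Q) := by
  simp [exs]

theorem exs_cons (y : ℕ) (zs : List ℕ) (Q : Query L) : exs (y :: zs) Q = ex y (exs zs Q) := rfl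

theorem mem_freeVars_exs {ys : List ℕ} {Q : Query L} {v : ℕ} :
    v ∈ (exs ys Q).freeVars ↔ v ∈ Q.freeVars ∧ v ∉ ys := by
  induction ys with
  | nil => simp [exs]
  | cons y ys ih =>
    rw [exs_cons]
    simp only [freeVars, Finset.mem_erase, ih, List.mem_cons, not_or]
    tauto

theorem conj_cons {Q : Query L} {l : List (Query L)} (h : l ≠ []) :
    conj (Q :: l) = and Q (conj l) := by
  cases l with
  | nil => exact absurd rfl h
  | cons _ _ => rfl

theorem substitutible_of_isEquation_or_isAtom {A : Query L} (h : A.IsEquation ∨ A.IsAtom)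
    (x : ℕ) (t : L.Term ℕ) : A.Substitutible x t := by
  rcases h with ⟨s, t, rfl⟩ | ⟨n, p, ts, rfl⟩ <;> trivial

theorem eq_or_isAtom_of_subst {A : Query L} (h : A.IsEquation ∨ A.IsAtom)
    (x : ℕ) (t : L.Term ℕ) : (A.subst x t).IsEquation ∨ (A.subst x t).IsAtom := by
  rcases h with ⟨s, t, rfl⟩ | ⟨n, p, ts, rfl⟩
  · exact Or.inl ⟨_, _, rfl⟩
  · exact Or.inr ⟨_, _, _, rfl⟩

end Query

open Query

/-! ### Semantics -/

section Semantics

variable {D : Type w} {J : PreInterp L D}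

theorem eval_congr {h h' : ℕ → D} {s : L.Term ℕ} (e : ∀ v ∈ s.varFinset, h v = h' v) :
    eval J h s = eval J h' s := by
  induction s with
  | var y => exact e y (by simp [Term.varFinset])
  | func f ts ih =>
    simp only [eval]
    congr 1
    funext i
    exact ih i (fun v hv => e v (mem_varFinset_func.2 ⟨i, hv⟩))

theorem eval_update_of_notMem {h : ℕ → D} {x : ℕ} {d : D} {s : L.Term ℕ}
    (hx : x ∉ s.varFinset) : eval J (Function.update h x d) s = eval J h s :=
  eval_congr fun v hv => Function.update_of_ne (fun e => hx (by rwa [e] at hv)) _ _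

theorem eval_substTerm (h : ℕ → D) (x : ℕ) (t s : L.Term ℕ) :
    eval J h (substTerm x t s) = eval J (Function.update h x (eval J h t)) s := by
  induction s with
  | var y =>
    rw [substTerm_var]
    split_ifs with e
    · subst e
      simp [eval]
    · simp [eval, e]
  | func f ts ih =>
    rw [substTerm_func]
    simp only [eval, ih]

theorem solutions_congr {Q : Query L} {Is : List (Interp L D)} {h h' : ℕ → D}
    (e : ∀ v ∈ Q.freeVars, h v = h' v) : h ∈ solutions J Q Is ↔ h' ∈ solutions J Q Is := by
  induction Q generalizing Is h h' with
  | tt => simp [solutions]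
  | ff => simp [solutions]
  | eq s t =>
    simp only [freeVars, Finset.mem_union] at e
    simp only [solutions, Set.mem_ofPred_eq]
    rw [eval_congr (fun v hv => e v (Or.inl hv)), eval_congr (fun v hv => e v (Or.inr hv))]
  | atom p ts =>
    have : (fun i => eval J h (ts i)) = fun i => eval J h' (ts i) := by
      funext i
      exact eval_congr (fun v hv => e v (mem_freeVars_atom.2 ⟨i, hv⟩))
    simp only [solutions, Set.mem_ofPred_eq, this]
  | and P R ihP ihR =>
    simp only [freeVars, Finset.mem_union] at e
    simp only [solutions, Set.mem_inter_iff]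
    rw [ihP (fun v hv => e v (Or.inl hv)), ihR (fun v hv => e v (Or.inr hv))]
  | ex y P ih =>
    simp only [solutions, Set.mem_ofPred_eq]
    refine exists_congr fun d => ih fun v hv => ?_
    by_cases hvy : v = y
    · subst hvy
      simp
    · rw [Function.update_of_ne hvy, Function.update_of_ne hvy]
      exact e v (by simp [freeVars, hv, hvy])

/-- Substitutibility matters only at a quantifier below which x is free: the bound variable is then
absent from t, so its update leaves the value of t alone and commutes with the update of x. -/
theorem solutions_subst {Q : Query L} {Is : List (Interp L D)} {h : ℕ → D} {x : ℕ}
    {t : L.Term ℕ} (hs : Q.Substitutible x t) :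
    h ∈ solutions J (Q.subst x t) Is ↔
      Function.update h x (eval J h t) ∈ solutions J Q Is := by
  induction Q generalizing Is h with
  | tt => simp [solutions, subst]
  | ff => simp [solutions, subst]
  | eq s t => simp [solutions, subst, eval_substTerm]
  | atom p ts => simp [solutions, subst, eval_substTerm]
  | and P R ihP ihR =>
    simp only [solutions, subst, Set.mem_inter_iff, card_subst]
    rw [ihP hs.1, ihR hs.2]
  | ex y P ih =>
    by_cases hx : x ∈ (Query.ex y P).freeVars
    · obtain ⟨hy, hs⟩ := hs.resolve_left (not_not_intro hx)
      have hxy : y ≠ x := fun e => by simp [freeVars, e] at hx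
      simp only [subst, if_neg hxy, solutions, Set.mem_ofPred_eq]
      refine exists_congr fun d => ?_
      rw [ih hs, eval_update_of_notMem hy, Function.update_comm hxy]
    · rw [subst_of_notMem hx]
      exact solutions_congr fun v hv =>
        (Function.update_of_ne (fun e => hx (by rwa [e] at hv)) _ _).symm

/-- Collapses the nested updates into one change of valuation, so prefixes with repeated variables
need no separate treatment. -/
theorem mem_solutions_exs {ys : List ℕ} {Q : Query L} {Is : List (Interp L D)} {h : ℕ → D} :
    h ∈ solutions J (exs ys Q) Is ↔
      ∃ h', (∀ v, v ∉ ys → h' v = h v) ∧ h' ∈ solutions J Q Is := by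
  induction ys generalizing h with
  | nil =>
    constructor
    · exact fun hh => ⟨h, fun _ _ => rfl, hh⟩
    · rintro ⟨h', e, hh⟩
      obtain rfl : h' = h := funext fun v => e v (by simp)
      exact hh
  | cons y ys ih =>
    simp only [exs_cons, solutions, Set.mem_ofPred_eq, ih]
    constructor
    · rintro ⟨d, h', e, hh⟩
      refine ⟨h', fun v hv => ?_, hh⟩
      simp only [List.mem_cons, not_or] at hv
      rw [e v hv.2, Function.update_of_ne hv.1]
    · rintro ⟨h', e, hh⟩
      refine ⟨h' y, h', fun v hv => ?_, hh⟩
      by_cases hvy : v = y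
      · subst hvy
        simp
      · rw [Function.update_of_ne hvy, e v (by simp [hv, hvy])]

theorem solutions_exs_and_left {ys : List ℕ} {P R : Query L} (Is : List (Interp L D))
    (hy : ∀ y ∈ ys, y ∉ R.freeVars) :
    solutions J (Query.and (exs ys P) R) Is = solutions J (exs ys (Query.and P R)) Is := by
  ext h
  simp only [solutions, Set.mem_inter_iff, mem_solutions_exs, card_exs]
  constructor
  · rintro ⟨⟨h', e, hP⟩, hR⟩
    exact ⟨h', e, hP,
      (solutions_congr fun v hv => e v (fun hvy => hy v hvy hv)).2 hR⟩
  · rintro ⟨h', e, hP, hR⟩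
    exact ⟨⟨h', e, hP⟩, (solutions_congr fun v hv => e v (fun hvy => hy v hvy hv)).1 hR⟩

theorem solutions_exs_and_right {ys : List ℕ} {P R : Query L} (Is : List (Interp L D))
    (hy : ∀ y ∈ ys, y ∉ P.freeVars) :
    solutions J (Query.and P (exs ys R)) Is = solutions J (exs ys (Query.and P R)) Is := by
  ext h
  simp only [solutions, Set.mem_inter_iff, mem_solutions_exs]
  constructor
  · rintro ⟨hP, ⟨h', e, hR⟩⟩
    exact ⟨h', e, (solutions_congr fun v hv => e v (fun hvy => hy v hvy hv)).2 hP, hR⟩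
  · rintro ⟨h', e, hP, hR⟩
    exact ⟨(solutions_congr fun v hv => e v (fun hvy => hy v hvy hv)).1 hP, h', e, hR⟩

/-- `h` is a solution of `A` exactly when `h'` is a solution of `A'`. -/
def PointEquiv (J : PreInterp L D) (h h' : ℕ → D) (A A' : Query L) : Prop :=
  A.card = A'.card ∧ ∀ Is : List (Interp L D), Is.length = A.card →
    (h ∈ solutions J A Is ↔ h' ∈ solutions J A' Is)

theorem PointEquiv.and {h h' : ℕ → D} {P P' R R' : Query L} (hP : PointEquiv J h h' P P')
    (hR : PointEquiv J h h' R R') : PointEquiv J h h' (Query.and P R) (Query.and P' R') := by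
  refine ⟨by simp [card, hP.1, hR.1], fun Is hIs => ?_⟩
  simp only [card] at hIs
  simp only [solutions, Set.mem_inter_iff, ← hP.1]
  rw [hP.2 _ (by simp; omega), hR.2 _ (by simp; omega)]

theorem PointEquiv.conj {h h' : ℕ → D} {l l' : List (Query L)}
    (hl : List.Forall₂ (PointEquiv J h h') l l') :
    PointEquiv J h h' (Query.conj l) (Query.conj l') := by
  induction hl with
  | nil => exact ⟨rfl, fun _ _ => by simp [Query.conj, solutions]⟩
  | @cons A A' l l' hA hl ih =>
    cases hl with
    | nil => exact hA
    | cons hB hl => exact hA.and ih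

/-- Two valuations are allowed because eliminating x in `r6` compares valuations that differ at x;
`r5` and `r7` use it with equal ones. -/
theorem PointEquiv.conj_of_map {h h' : ℕ → D} {Q₁ Q₂ : List (Query L)} {e e' : Query L}
    {g : Query L → Query L} (hg : ∀ A ∈ Q₁ ++ Q₂, PointEquiv J h h' A (g A))
    (he : PointEquiv J h h' e e') :
    PointEquiv J h h' (Query.conj (Q₁ ++ e :: Q₂)) (Query.conj (Q₁.map g ++ e' :: Q₂.map g)) := by
  have aux : ∀ l : List (Query L), (∀ A ∈ l, PointEquiv J h h' A (g A)) →
      List.Forall₂ (PointEquiv J h h') l (l.map g) := fun l hl => by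
    rw [List.forall₂_map_right_iff, List.forall₂_same]
    exact hl
  refine PointEquiv.conj (List.rel_append (aux _ fun A hA => hg A ?_)
    (List.Forall₂.cons he (aux _ fun A hA => hg A ?_))) <;> simp [hA]

theorem eval_eq_of_mem_solutions_conj {h : ℕ → D} {l : List (Query L)} {s t : L.Term ℕ}
    (hst : Query.eq s t ∈ l) {Is : List (Interp L D)}
    (hh : h ∈ solutions J (conj l) Is) : eval J h s = eval J h t := by
  induction l generalizing Is with
  | nil => simp at hst
  | cons A l ih =>
    cases l with
    | nil =>
      obtain rfl : Query.eq s t = A := by simpa using hst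
      exact hh
    | cons B l =>
      rcases List.mem_cons.1 hst with rfl | hst
      · exact hh.1
      · exact ih hst hh.2

theorem pointEquiv_subst {h : ℕ → D} {A : Query L} {x : ℕ} {t : L.Term ℕ}
    (hs : A.Substitutible x t) :
    PointEquiv J (Function.update h x (eval J h t)) h A (A.subst x t) :=
  ⟨(card_subst _ _ _).symm, fun _ _ => (solutions_subst hs).symm⟩

end Semantics

/-! ### Soundness of the steps -/

/-- Equality of the numbers of atoms and of the solutions over all models of the free equality
axioms. -/
def SolEquiv (P P' : Query L) : Prop :=
  P.card = P'.card ∧ ∀ (D : Type w) (J : PreInterp L D), IsFEAModel J →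
    ∀ Is : List (Interp L D), Is.length = P.card → solutions J P Is = solutions J P' Is

namespace SolEquiv

theorem refl (P : Query L) : SolEquiv.{u, v, w} P P := ⟨rfl, fun _ _ _ _ _ => rfl⟩

theorem symm {P P' : Query L} (h : SolEquiv.{u, v, w} P P') : SolEquiv.{u, v, w} P' P :=
  ⟨h.1.symm, fun D J hJ Is hIs => (h.2 D J hJ Is (hIs.trans h.1.symm)).symm⟩

theorem trans {P P' P'' : Query L} (h : SolEquiv.{u, v, w} P P')
    (h' : SolEquiv.{u, v, w} P' P'') : SolEquiv.{u, v, w} P P'' :=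
  ⟨h.1.trans h'.1, fun D J hJ Is hIs =>
    (h.2 D J hJ Is hIs).trans (h'.2 D J hJ Is (hIs.trans h.1))⟩

theorem and {P P' R R' : Query L} (h : SolEquiv.{u, v, w} P P') (h' : SolEquiv.{u, v, w} R R') :
    SolEquiv.{u, v, w} (Query.and P R) (Query.and P' R') := by
  refine ⟨by simp [card, h.1, h'.1], fun D J hJ Is hIs => ?_⟩
  simp only [card] at hIs
  simp only [solutions, ← h.1]
  rw [h.2 D J hJ _ (by simp; omega), h'.2 D J hJ _ (by simp; omega)]

theorem ex (x : ℕ) {P P' : Query L} (h : SolEquiv.{u, v, w} P P') :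
    SolEquiv.{u, v, w} (Query.ex x P) (Query.ex x P') := by
  refine ⟨h.1, fun D J hJ Is hIs => ?_⟩
  simp only [solutions]
  rw [h.2 D J hJ _ hIs]

theorem exs (ys : List ℕ) {P P' : Query L} (h : SolEquiv.{u, v, w} P P') :
    SolEquiv.{u, v, w} (Query.exs ys P) (Query.exs ys P') := by
  induction ys with
  | nil => exact h
  | cons y ys ih => exact ih.ex y

theorem of_everywhere {r : Query L → Query L → Prop}
    (hr : ∀ P P', r P P' → SolEquiv.{u, v, w} P P') {P P' : Query L} (h : Everywhere r P P') :
    SolEquiv.{u, v, w} P P' := by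
  induction h with
  | here h => exact hr _ _ h
  | andLeft R _ ih => exact ih.and (refl R)
  | andRight R _ ih => exact (refl R).and ih
  | ex x _ ih => exact ih.ex x

theorem of_assocRule {P P' : Query L} (h : AssocRule P P') : SolEquiv.{u, v, w} P P' := by
  obtain ⟨P, Q, R⟩ := h
  refine ⟨by simp [card, add_assoc], fun D J hJ Is hIs => ?_⟩
  simp only [solutions, card, List.take_take, List.drop_take, List.drop_drop, Set.inter_assoc]
  congr 2
  · congr 1
    omega
  · congr 2
    omega

theorem of_assocEq {P P' : Query L} (h : AssocEq P P') : SolEquiv.{u, v, w} P P' := by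
  induction h with
  | rel _ _ h => exact of_everywhere (fun _ _ => of_assocRule) h
  | refl P => exact refl P
  | symm _ _ _ ih => exact ih.symm
  | trans _ _ _ _ _ ih ih' => exact ih.trans ih'

theorem of_renameRule {P P' : Query L} (h : RenameRule P P') : SolEquiv.{u, v, w} P P' := by
  obtain ⟨x, y, G, hy, hs⟩ := h
  refine ⟨(card_subst x (Term.var y) G).symm, fun D J hJ Is hIs => ?_⟩
  ext h
  simp only [solutions, Set.mem_ofPred_eq]
  refine exists_congr fun d => ?_
  rw [solutions_subst hs]
  refine solutions_congr fun v hv => ?_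
  have hvy : v ≠ y := fun e => hy (e ▸ hv)
  by_cases hvx : v = x
  · subst hvx
    simp [eval]
  · simp [hvx, hvy]

theorem of_variant {P P' : Query L} (h : Variant P P') : SolEquiv.{u, v, w} P P' := by
  induction h with
  | refl => exact refl P
  | tail _ h ih => exact ih.trans (of_everywhere (fun _ _ => of_renameRule) h)

theorem card_conj_of_isEquation (l : List (Query L)) (hl : ∀ A ∈ l, A.IsEquation) :
    (Query.conj l).card = 0 := by
  induction l with
  | nil => rfl
  | cons A l ih =>
    obtain ⟨s, t, rfl⟩ := hl A (by simp)
    have := ih fun A hA => hl A (by simp [hA])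
    cases l with
    | nil => rfl
    | cons B l => simpa [Query.conj, card] using this

theorem mem_solutions_conj_eqs {D : Type w} {J : PreInterp L D} {h : ℕ → D}
    (l : List (L.Term ℕ × L.Term ℕ)) (Is : List (Interp L D)) :
    h ∈ solutions J (Query.conj (l.map fun p => Query.eq p.1 p.2)) Is ↔
      ∀ p ∈ l, eval J h p.1 = eval J h p.2 := by
  induction l generalizing Is with
  | nil => simp [Query.conj, solutions]
  | cons p l ih =>
    cases l with
    | nil => simp [Query.conj, solutions]
    | cons q l =>
      have := ih (Is.drop 0)
      rw [List.forall_mem_cons, ← this]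
      rfl

/-- The free equality axioms are needed for `r1` (injectivity), `r2` (disjointness) and `r3`
(acyclicity). The other cases are purely logical. -/
theorem of_localRule {P P' : Query L} (h : LocalRule P P') : SolEquiv.{u, v, w} P P' := by
  cases h with
  | @r1 n f s t =>
    refine ⟨?_, fun D J hJ Is hIs => ?_⟩
    · rw [card_conj_of_isEquation]
      · rfl
      · intro A hA
        obtain ⟨i, rfl⟩ := (List.mem_ofFn' _ _).1 hA
        exact ⟨_, _, rfl⟩
    · ext h
      have : (List.ofFn fun i => Query.eq (s i) (t i)) =
          (List.ofFn fun i => (s i, t i)).map fun p => Query.eq p.1 p.2 := by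
        rw [List.map_ofFn]
        rfl
      rw [this, mem_solutions_conj_eqs]
      simp only [solutions, Set.mem_ofPred_eq, eval, hJ.injective]
      constructor
      · intro H p hp
        obtain ⟨i, rfl⟩ := (List.mem_ofFn' _ _).1 hp
        exact H i
      · exact fun H i => H (s i, t i) ((List.mem_ofFn' _ _).2 ⟨i, rfl⟩)
  | r2 f g s t hfg =>
    refine ⟨rfl, fun D J hJ Is hIs => ?_⟩
    ext h
    simpa [solutions, eval] using hJ.disjoint _ _ f g _ _ hfg
  | r3 x t htx hxt =>
    refine ⟨rfl, fun D J hJ Is hIs => ?_⟩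
    ext h
    simpa [solutions, eval] using hJ.acyclic h x t htx hxt
  | r4 x => exact ⟨rfl, fun D J hJ Is hIs => by simp [solutions]⟩
  | r8 ys zs y Q hy =>
    simp only [exs_append]
    refine SolEquiv.exs ys ⟨rfl, fun D J hJ Is hIs => ?_⟩
    ext h
    simp only [exs_cons, solutions, Set.mem_ofPred_eq]
    have (d : D) : Function.update h y d ∈ solutions J (Query.exs zs Q) Is ↔
        h ∈ solutions J (Query.exs zs Q) Is :=
      solutions_congr fun v hv => Function.update_of_ne (fun e => hy (by rwa [e] at hv)) _ _
    simp only [this]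
    -- A valuation already supplies an element of the domain, so nonemptiness need not be assumed.
    exact ⟨fun ⟨_, H⟩ => H, fun H => ⟨h y, H⟩⟩
  | r9 ys₁ ys₂ zs₁ zs₂ Q₁ Q₂ R₁ R₂ _ _ _ h₁ h₂ hz₂ hz₁ =>
    refine ((of_variant h₁).and (of_variant h₂)).trans
      ⟨by simp [card, card_exs], fun D J hJ Is hIs => ?_⟩
    rw [solutions_exs_and_left]
    · have hIs' : Is.length = (Query.and R₁ (Query.exs zs₂ R₂)).card := by
        simpa [card, card_exs] using hIs
      have : SolEquiv.{u, v, w} (Query.and R₁ (Query.exs zs₂ R₂))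
          (Query.exs zs₂ (Query.and R₁ R₂)) :=
        ⟨by simp [card, card_exs], fun D J hJ Is hIs => solutions_exs_and_right _ hz₂⟩
      exact (this.exs zs₁).2 D J hJ Is (by rw [card_exs, hIs'])
    · intro z hz hz'
      exact hz₁ z hz (mem_freeVars_exs.1 hz').1
  | r10 A s t hA =>
    refine ⟨by simp [card], fun D J hJ Is hIs => ?_⟩
    -- The equation contains no atom, so in both orders the whole list of interpretations belongs to
    -- `A`.
    have : Is.take A.card = Is := List.take_of_length_le (by rw [hIs]; simp [card])
    simp only [solutions, card, List.drop_zero, this]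
    rw [Set.inter_comm]
  | r11_left Q =>
    refine ⟨by simp [card], fun D J hJ Is hIs => ?_⟩
    simp [solutions, card]
  | r11_right Q =>
    refine ⟨by simp [card], fun D J hJ Is hIs => ?_⟩
    have : Is.take P'.card = Is := List.take_of_length_le (by rw [hIs]; simp [card])
    simp [solutions, this]

/-- Leaf by leaf, replacing x by t changes nothing at valuations where both have the same value. In
`r5` the retained equation forces this; in `r6` the quantifier on x allows choosing such a
valuation. -/
theorem of_blockRule (ws : List ℕ) {ys : List ℕ} {B B' : Query L} (h : BlockRule ys B B') :
    SolEquiv.{u, v, w} (Query.exs (ws ++ ys) B) (Query.exs (ws ++ ys) B') := by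
  have hpt : ∀ {D : Type w} {J : PreInterp L D} {h : ℕ → D} {A : Query L} {x : ℕ}
      {t : L.Term ℕ}, (A.IsEquation ∨ A.IsAtom) → h x = eval J h t →
      PointEquiv J h h A (A.subst x t) := by
    intro D J h A x t hA hx
    have := pointEquiv_subst (J := J) (h := h) (substitutible_of_isEquation_or_isAtom hA x t)
    rwa [← hx, Function.update_eq_self] at this
  cases h with
  | r5 Q₁ Q₂ x t hA hxt hx _ =>
    refine SolEquiv.exs _ ⟨?_, fun D J hJ Is hIs => ?_⟩
    -- The number of atoms does not depend on a model; it is read off from the one-point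
    -- pre-interpretation.
    · have := (PointEquiv.conj_of_map (J := fun _ _ _ => PUnit.unit) (h := fun _ => PUnit.unit)
        (h' := fun _ => PUnit.unit) (e := Query.eq (Term.var x) t) (e' := Query.eq (Term.var x) t)
        (fun A h => hpt (x := x) (t := t) (hA A h) rfl) ⟨rfl, fun _ _ => Iff.rfl⟩).1
      exact this
    · ext h
      by_cases hx : h x = eval J h t
      · exact (PointEquiv.conj_of_map (fun A h => hpt (hA A h) hx)
          ⟨rfl, fun _ _ => Iff.rfl⟩).2 Is hIs
      -- Both conjunctions contain x = t, so both fail here.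
      · refine iff_of_false (fun hh => hx ?_) (fun hh => hx ?_) <;>
        exact eval_eq_of_mem_solutions_conj (s := Term.var x) (t := t) (by simp) hh
  | r6 Q₁ Q₂ x t hA hxt hx =>
    have key : ∀ {D : Type w} {J : PreInterp L D} (h : ℕ → D),
        PointEquiv J (Function.update h x (eval J h t)) h
          (Query.conj (Q₁ ++ Query.eq (Term.var x) t :: Q₂))
          (Query.conj (Q₁.map (subst x t) ++ Query.tt :: Q₂.map (subst x t))) := fun h =>
      PointEquiv.conj_of_map
        (fun A hh => pointEquiv_subst (substitutible_of_isEquation_or_isAtom (hA A hh) x t))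
        ⟨rfl, fun Is _ => by simp [solutions, eval, eval_update_of_notMem hxt]⟩
    have hcard := (key (J := fun _ _ _ => PUnit.unit) (fun _ => PUnit.unit)).1
    refine ⟨by simp only [card_exs, hcard], fun D J hJ Is hIs => ?_⟩
    rw [card_exs] at hIs
    ext h
    simp only [mem_solutions_exs]
    constructor
    · rintro ⟨h', e, hh⟩
      refine ⟨h', e, ?_⟩
      have hx : h' x = eval J h' t :=
        eval_eq_of_mem_solutions_conj (s := Term.var x) (t := t) (by simp) hh
      refine ((PointEquiv.conj_of_map (g := subst x t) (e := Query.eq (Term.var x) t)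
        (e' := Query.tt) (fun A h => hpt (hA A h) hx) ⟨rfl, fun _ _ => ?_⟩).2 Is hIs).1 hh
      simpa [solutions, eval] using hx
    · rintro ⟨h', e, hh⟩
      -- The witness resets x to the value of t, which is permitted because x is quantified.
      refine ⟨_, fun v hv => ?_, ((key h').2 Is hIs).2 hh⟩
      rw [Function.update_of_ne, e v hv]
      rintro rfl
      exact hv (by simp [hx])
  | r7 Q₁ Q₂ x t hA _ =>
    have key : ∀ {D : Type w} {J : PreInterp L D} (h : ℕ → D), PointEquiv J h h
        (Query.conj (Q₁ ++ Query.eq t (Term.var x) :: Q₂))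
        (Query.conj (Q₁ ++ Query.eq (Term.var x) t :: Q₂)) := fun h => by
      have := PointEquiv.conj_of_map (J := ‹_›) (h := h) (h' := h) (Q₁ := Q₁) (Q₂ := Q₂)
        (e := Query.eq t (Term.var x)) (e' := Query.eq (Term.var x) t) (g := id)
        (fun A _ => ⟨rfl, fun _ _ => Iff.rfl⟩) ⟨rfl, fun _ _ => ?_⟩
      · simpa using this
      · simp [solutions, eq_comm]
    exact SolEquiv.exs _ ⟨(key (J := fun _ _ _ => PUnit.unit) (fun _ => PUnit.unit)).1,
      fun D J hJ Is hIs => Set.ext fun h => (key h).2 Is hIs⟩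

theorem of_blockStep {ws : List ℕ} {P P' : Query L} (h : BlockStep ws P P') :
    SolEquiv.{u, v, w} P P' := by
  obtain ⟨xs, ys, B, B', h⟩ := h
  exact of_blockRule xs h

end SolEquiv

/-! ### Falsity, runs of the algorithm, and the notions of equivalence -/

theorem solutions_eq_empty_of_hasFF {D : Type w} (J : PreInterp L D) {Q : Query L}
    (h : Q.HasFF) (Is : List (Interp L D)) : solutions J Q Is = ∅ := by
  induction Q generalizing Is with
  | tt => exact h.elim
  | ff => rfl
  | eq => exact h.elim
  | atom => exact h.elim
  | and P R ihP ihR =>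
    rcases h with h | h
    · simp [solutions, ihP h]
    · simp [solutions, ihR h]
  | ex x P ih =>
    have := ih h
    simp [solutions, this]

/-- Both sides of a rebracketing contain conjunctions, so a constant is alone in its class. Working
up to bracketing therefore does not blur the stopping condition. -/
theorem eq_of_assocEq_const {c P : Query L} (hc : c = Query.tt ∨ c = Query.ff)
    (h : AssocEq c P) : P = c := by
  have key : ∀ P P' : Query L, AssocEq P P' → (P = c ↔ P' = c) := by
    intro P P' h
    induction h with
    | rel _ _ h =>
      cases h with
      | here h =>
        obtain ⟨⟩ := h
        rcases hc with rfl | rfl <;> simp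
      | _ => rcases hc with rfl | rfl <;> simp
    | refl => rfl
    | symm _ _ _ ih => exact ih.symm
    | trans _ _ _ _ _ ih ih' => exact ih.trans ih'
  exact (key _ _ h).1 rfl

theorem eq_of_assocEq_ff {P : Query L} (h : AssocEq Query.ff P) : P = Query.ff :=
  eq_of_assocEq_const (Or.inr rfl) h

theorem solEquiv_or_of_step {Q Q' : Query L} (h : Step Q Q') :
    SolEquiv.{u, v, w} Q Q' ∨ (Q' = Query.ff ∧ Unsolvable.{u, v, w} Q) := by
  obtain ⟨_, P, P', hP, h, hP'⟩ := h
  have key : SolEquiv.{u, v, w} P P' → SolEquiv.{u, v, w} Q Q' := fun h =>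
    ((SolEquiv.of_assocEq hP).trans h).trans (SolEquiv.of_assocEq hP')
  cases h with
  | anywhere h => exact Or.inl (key (SolEquiv.of_everywhere (fun _ _ => SolEquiv.of_localRule) h))
  | wholeBlock ws h => exact Or.inl (key (SolEquiv.of_blockStep h))
  | innerBlock h =>
    exact Or.inl (key (SolEquiv.of_everywhere (fun _ _ ⟨_, _, h⟩ => SolEquiv.of_blockStep h) h))
  | r12 h =>
    refine Or.inr ⟨eq_of_assocEq_ff hP', fun D _ J hJ Is hIs => ?_⟩
    rw [(SolEquiv.of_assocEq hP).2 D J hJ Is hIs, solutions_eq_empty_of_hasFF J h]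

/-- The exceptional alternative can only arise at the last step, since `ff` has no successor; all
earlier steps transport unsolvability back to the input. -/
theorem solEquiv_or_of_reachable {Q Q' : Query L} (h : Relation.ReflTransGen Step Q Q') :
    SolEquiv.{u, v, w} Q Q' ∨ (Q' = Query.ff ∧ Unsolvable.{u, v, w} Q) := by
  induction h with
  | refl => exact Or.inl (SolEquiv.refl Q)
  | tail _ h ih =>
    rcases ih with ih | ⟨e, _⟩
    · rcases solEquiv_or_of_step h with h | ⟨e, hu⟩
      · exact Or.inl (ih.trans h)
      · refine Or.inr ⟨e, fun D _ J hJ Is hIs => ?_⟩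
        rw [ih.2 D J hJ Is hIs]
        exact hu D J hJ Is (hIs.trans ih.1)
    · exact absurd e h.1

theorem SolEquiv.equivalent {Q Q' : Query L} (h : SolEquiv.{u, v, w} Q Q') :
    Equivalent.{u, v, w} Q Q' :=
  ⟨⟨h.1, fun D _ J hJ => ⟨h.1, fun Is hIs => (h.2 D J hJ Is hIs).subset⟩⟩,
    ⟨h.1.symm, fun D _ J hJ => ⟨h.1.symm, fun Is hIs => (h.symm.2 D J hJ Is hIs).subset⟩⟩⟩

/-- Ordinary truth is the special case of a constant multiinterpretation; this is how logical
equivalence follows from equality of solutions. -/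
theorem holds_iff_mem_solutions {D : Type w} (J : PreInterp L D) (I : Interp L D) (h : ℕ → D)
    (Q : Query L) {Is : List (Interp L D)} (hIs : Is = List.replicate Q.card I) :
    Holds J I h Q ↔ h ∈ solutions J Q Is := by
  induction Q generalizing h Is with
  | tt => simp [Holds, solutions]
  | ff => simp [Holds, solutions]
  | eq => simp [Holds, solutions]
  | atom => simp [Holds, solutions, hIs, card]
  | and P R ihP ihR =>
    simp only [Holds, solutions, Set.mem_inter_iff]
    rw [ihP h (Is := Is.take P.card) (by simp [hIs, card]),
      ihR h (Is := Is.drop P.card) (by simp [hIs, card])]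
  | ex x P ih =>
    simp only [Holds, solutions, Set.mem_ofPred_eq]
    exact exists_congr fun d => ih _ hIs

theorem SolEquiv.feaEquivalent {Q Q' : Query L} (h : SolEquiv.{u, v, w} Q Q') :
    FEAEquivalent.{u, v, w} Q Q' := fun D _ J hJ I g => by
  rw [holds_iff_mem_solutions J I g Q rfl, holds_iff_mem_solutions J I g Q' rfl, ← h.1,
    h.2 D J hJ _ (by simp)]

theorem Unsolvable.feaEquivalent_ff {Q : Query L} (h : Unsolvable.{u, v, w} Q) :
    FEAEquivalent.{u, v, w} Q Query.ff := fun D _ J hJ I g => by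
  rw [holds_iff_mem_solutions J I g Q rfl, h D J hJ _ (by simp)]
  simp [Holds]

theorem Unsolvable.equivalent_ff {Q : Query L} (h : Unsolvable.{u, v, w} Q) (hQ : Q.card = 0) :
    Equivalent.{u, v, w} Q Query.ff := by
  refine ⟨⟨hQ, fun D _ J hJ => ⟨hQ, fun Is hIs => ?_⟩⟩,
    ⟨hQ.symm, fun D _ J hJ => ⟨hQ.symm, fun Is hIs => ?_⟩⟩⟩
  · simp [h D J hJ Is hIs]
  · simp [solutions]

theorem Unsolvable.of_solEquiv_ff {Q : Query L} (h : SolEquiv.{u, v, w} Q Query.ff) :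
    Unsolvable.{u, v, w} Q := fun D _ J hJ Is hIs => h.2 D J hJ Is hIs

/-! ### Unsolved variables of a multiset of equations and atoms -/

theorem countP_le_countP_map {α β : Type*} {p : α → Prop} {q : β → Prop} [DecidablePred p]
    [DecidablePred q] {f : α → β} {M : Multiset α} (h : ∀ a ∈ M, p a → q (f a)) :
    M.countP p ≤ (M.map f).countP q := by
  induction M using Multiset.induction with
  | empty => simp
  | cons a M ih =>
    have := ih fun b hb => h b (Multiset.mem_cons_of_mem hb)
    have ha := h a (Multiset.mem_cons_self a M)
    rw [Multiset.map_cons, Multiset.countP_cons, Multiset.countP_cons]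
    split_ifs <;> first | omega | tauto

theorem countP_map_congr {α β : Type*} {p : α → Prop} {q : β → Prop} [DecidablePred p]
    [DecidablePred q] {f : α → β} {M : Multiset α} (h : ∀ a ∈ M, p a ↔ q (f a)) :
    M.countP p = (M.map f).countP q := by
  induction M using Multiset.induction with
  | empty => simp
  | cons a M ih =>
    have := ih fun b hb => h b (Multiset.mem_cons_of_mem hb)
    have ha := h a (Multiset.mem_cons_self a M)
    rw [Multiset.map_cons, Multiset.countP_cons, Multiset.countP_cons]
    simp only [ha, this]

/-- Double counting of the pairs (a, b) with b in `r a`. -/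
theorem countP_le_sum_countP {α β : Type*} [DecidableEq β] {p : α → Prop} [DecidablePred p]
    {r : α → Finset β} {S : Finset β} {M : Multiset α}
    (h : ∀ a ∈ M, p a → ∃ b ∈ S, b ∈ r a) :
    M.countP p ≤ ∑ b ∈ S, M.countP (fun a => b ∈ r a) := by
  induction M using Multiset.induction with
  | empty => simp
  | cons a M ih =>
    have ih := ih fun b hb => h b (Multiset.mem_cons_of_mem hb)
    simp only [Multiset.countP_cons, Finset.sum_add_distrib]
    refine Nat.add_le_add ih ?_
    split_ifs with hp
    · obtain ⟨b, hb, hba⟩ := h a (Multiset.mem_cons_self a M) hp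
      exact (by simp [hba] : 1 ≤ if b ∈ r a then 1 else 0).trans
        (Finset.single_le_sum (f := fun b => if b ∈ r a then 1 else 0)
          (fun _ _ => Nat.zero_le _) hb)
    · exact Nat.zero_le _

/-- The variables that are free in some member of `A`. -/
def vars (A : Multiset (Query L)) : Finset ℕ := (A.bind fun q => q.freeVars.val).toFinset

theorem mem_vars {A : Multiset (Query L)} {v : ℕ} : v ∈ vars A ↔ ∃ q ∈ A, v ∈ q.freeVars := by
  simp [vars]

/-- The number of members of `A` in which `v` is free. -/
def occ (A : Multiset (Query L)) (v : ℕ) : ℕ := A.countP (fun q => v ∈ q.freeVars)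

theorem occ_cons (q : Query L) (A : Multiset (Query L)) (v : ℕ) :
    occ (q ::ₘ A) v = occ A v + if v ∈ q.freeVars then 1 else 0 :=
  Multiset.countP_cons _ _ _

theorem occ_add (A B : Multiset (Query L)) (v : ℕ) : occ (A + B) v = occ A v + occ B v :=
  Multiset.countP_add _ _ _

theorem occ_eq_zero {A : Multiset (Query L)} {v : ℕ} : occ A v = 0 ↔ v ∉ vars A := by
  simp [occ, Multiset.countP_eq_zero, mem_vars]

theorem occ_pos {A : Multiset (Query L)} {v : ℕ} : 0 < occ A v ↔ v ∈ vars A := by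
  rw [Nat.pos_iff_ne_zero, ne_eq, occ_eq_zero, not_not]

/-- `q` is an equation with `x` as one side, and `x` does not occur in the other side. -/
def IsSide (q : Query L) (x : ℕ) : Prop :=
  ∃ t : L.Term ℕ, x ∉ t.varFinset ∧
    (q = Query.eq (Term.var x) t ∨ q = Query.eq t (Term.var x))

theorem IsSide.mem_freeVars {q : Query L} {x : ℕ} (h : IsSide q x) : x ∈ q.freeVars := by
  obtain ⟨t, -, rfl | rfl⟩ := h <;> simp [Query.freeVars]

/-- The equation `q` of `A` has a side that is a variable without other occurrences in `A`. -/
def Solved (A : Multiset (Query L)) (q : Query L) : Prop := ∃ x, IsSide q x ∧ occ A x = 1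

open Classical in
/-- The number of variables of `A` minus the number of solved equations of `A`. -/
noncomputable def unsolvedCount (A : Multiset (Query L)) : ℕ :=
  (vars A).card - A.countP (Solved A)

open Classical in
-- Each solved equation contains a variable occurring in that member only, and such a variable
-- serves just one member. Hence the subtraction in `unsolvedCount` is never truncated.
theorem countP_solved_le (A : Multiset (Query L)) : A.countP (Solved A) ≤ (vars A).card := by
  have h := countP_le_sum_countP (p := Solved A) (M := A) (r := Query.freeVars)
    (S := (vars A).filter fun v => occ A v = 1) (by
      rintro q hq ⟨x, hx, hx'⟩
      exact ⟨x, by simpa [hx', mem_vars] using ⟨q, hq, hx.mem_freeVars⟩, hx.mem_freeVars⟩)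
  refine h.trans (le_trans (le_of_eq ?_) (Finset.card_filter_le _ fun v => occ A v = 1))
  rw [Finset.card_eq_sum_ones]
  exact Finset.sum_congr rfl fun v hv => (Finset.mem_filter.1 hv).2

theorem vars_cons_subset {e : Query L} {A' M : Multiset (Query L)}
    (h : vars A' ⊆ e.freeVars) : vars (A' + M) ⊆ vars (e ::ₘ M) := by
  intro v hv
  obtain ⟨q, hq, hv⟩ := mem_vars.1 hv
  rcases Multiset.mem_add.1 hq with hq | hq
  · exact mem_vars.2 ⟨e, by simp, h (mem_vars.2 ⟨q, hq, hv⟩)⟩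
  · exact mem_vars.2 ⟨q, by simp [hq], hv⟩

/-- The leaf `e` is not itself solved. A variable isolated in another member is absent from `e`,
hence from its replacement, so solved equations stay solved while no variable is added. -/
theorem unsolvedCount_replace_le {e : Query L} {A' : Multiset (Query L)}
    (he : ∀ x, ¬ IsSide e x) (hA' : vars A' ⊆ e.freeVars) (M : Multiset (Query L)) :
    unsolvedCount (A' + M) ≤ unsolvedCount (e ::ₘ M) := by
  classical
  have h₁ := Finset.card_le_card (vars_cons_subset (M := M) hA')
  have h₂ : (e ::ₘ M).countP (Solved (e ::ₘ M)) = M.countP (Solved (e ::ₘ M)) :=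
    Multiset.countP_cons_of_neg _ fun ⟨x, hx, _⟩ => he x hx
  have h₃ : M.countP (Solved (e ::ₘ M)) ≤ M.countP (Solved (A' + M)) := by
    have := countP_le_countP_map (p := Solved (e ::ₘ M)) (q := Solved (A' + M)) (M := M)
      (f := id) ?_
    · simpa using this
    · rintro q hq ⟨x, hx, hx'⟩
      refine ⟨x, hx, ?_⟩
      have hM : 0 < occ M x := occ_pos.2 (mem_vars.2 ⟨q, hq, hx.mem_freeVars⟩)
      rw [occ_cons] at hx'
      have hxe : x ∉ e.freeVars := fun h => by simp [h] at hx'; omega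
      have : occ A' x = 0 := occ_eq_zero.2 fun h => hxe (hA' h)
      rw [occ_add, this]
      simp [hxe] at hx'
      omega
  have h₄ : M.countP (Solved (A' + M)) ≤ (A' + M).countP (Solved (A' + M)) := by
    rw [Multiset.countP_add]
    omega
  unfold unsolvedCount
  omega

/-! ### Substitution in a multiset of equations and atoms -/

theorem mem_freeVars_subst {A : Query L} (hA : A.IsEquation ∨ A.IsAtom) {x v : ℕ}
    {t : L.Term ℕ} : v ∈ (A.subst x t).freeVars ↔
      (v ≠ x ∧ v ∈ A.freeVars) ∨ (x ∈ A.freeVars ∧ v ∈ t.varFinset) := by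
  rcases hA with ⟨s, s', rfl⟩ | ⟨n, p, ts, rfl⟩
  · simp only [Query.subst, Query.freeVars, Finset.mem_union, mem_varFinset_substTerm]
    tauto
  · simp only [Query.subst, Query.mem_freeVars_atom, mem_varFinset_substTerm]
    constructor
    · rintro ⟨i, h | h⟩
      · exact Or.inl ⟨h.1, i, h.2⟩
      · exact Or.inr ⟨⟨i, h.1⟩, h.2⟩
    · rintro (⟨h, i, hi⟩ | ⟨⟨i, hi⟩, h⟩)
      · exact ⟨i, Or.inl ⟨h, hi⟩⟩
      · exact ⟨i, Or.inr ⟨hi, h⟩⟩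

theorem IsSide.subst {A : Query L} {x v : ℕ} {t : L.Term ℕ} (h : IsSide A v) (hvx : v ≠ x)
    (hvt : v ∉ t.varFinset) : IsSide (A.subst x t) v := by
  obtain ⟨s, hs, rfl | rfl⟩ := h
  · exact ⟨substTerm x t s, by rw [mem_varFinset_substTerm]; tauto,
      Or.inl (by simp [Query.subst, substTerm_var, hvx])⟩
  · exact ⟨substTerm x t s, by rw [mem_varFinset_substTerm]; tauto,
      Or.inr (by simp [Query.subst, substTerm_var, hvx])⟩

section Subst

variable {M : Multiset (Query L)} {x : ℕ} {t : L.Term ℕ}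

theorem notMem_vars_map_subst (hM : ∀ A ∈ M, A.IsEquation ∨ A.IsAtom) (hxt : x ∉ t.varFinset) :
    x ∉ vars (M.map (Query.subst x t)) := by
  rw [mem_vars]
  rintro ⟨q, hq, hx⟩
  obtain ⟨A, hA, rfl⟩ := Multiset.mem_map.1 hq
  rw [mem_freeVars_subst (hM A hA)] at hx
  tauto

theorem vars_cons_map_subst_subset (hM : ∀ A ∈ M, A.IsEquation ∨ A.IsAtom) {c : Query L}
    (hc : c.freeVars ⊆ (Query.eq (Term.var x) t).freeVars) :
    vars (c ::ₘ M.map (Query.subst x t)) ⊆ vars (Query.eq (Term.var x) t ::ₘ M) := by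
  intro v hv
  obtain ⟨q, hq, hvq⟩ := mem_vars.1 hv
  rcases Multiset.mem_cons.1 hq with rfl | hq
  · exact mem_vars.2 ⟨_, Multiset.mem_cons_self _ _, hc hvq⟩
  · obtain ⟨A, hA, rfl⟩ := Multiset.mem_map.1 hq
    rw [mem_freeVars_subst (hM A hA)] at hvq
    rcases hvq with hvq | hvq
    · exact mem_vars.2 ⟨A, by simp [hA], hvq.2⟩
    · exact mem_vars.2 ⟨_, Multiset.mem_cons_self _ _, by simp [Query.freeVars, hvq.2]⟩

theorem occ_map_subst (hM : ∀ A ∈ M, A.IsEquation ∨ A.IsAtom) {v : ℕ} (hvx : v ≠ x)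
    (hvt : v ∉ t.varFinset) : occ (M.map (Query.subst x t)) v = occ M v := by
  refine (countP_map_congr fun A hA => ?_).symm
  rw [mem_freeVars_subst (hM A hA)]
  tauto

open Classical in
-- A variable isolated in a member of `M` does not occur in x = t, so the substitution neither
-- removes it nor creates new occurrences of it.
theorem countP_solved_subst_le (hM : ∀ A ∈ M, A.IsEquation ∨ A.IsAtom) {c : Query L}
    (hc : c.freeVars ⊆ (Query.eq (Term.var x) t).freeVars) :
    M.countP (Solved (Query.eq (Term.var x) t ::ₘ M)) ≤
      (M.map (Query.subst x t)).countP (Solved (c ::ₘ M.map (Query.subst x t))) := by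
  refine countP_le_countP_map ?_
  rintro A hA ⟨v, hv, hv'⟩
  have hpos : 0 < occ M v := occ_pos.2 (mem_vars.2 ⟨A, hA, hv.mem_freeVars⟩)
  rw [occ_cons] at hv'
  have hve : v ∉ (Query.eq (Term.var x) t).freeVars := fun h => by simp [h] at hv'; omega
  have hvc : v ∉ c.freeVars := fun h => hve (hc h)
  have hve' := hve
  simp only [Query.freeVars, Term.varFinset, Finset.mem_union, Finset.mem_singleton,
    not_or] at hve'
  refine ⟨v, hv.subst hve'.1 hve'.2, ?_⟩
  rw [occ_cons, occ_map_subst hM hve'.1 hve'.2]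
  simpa [hvc, hve] using hv'

/-- An equation `x = t` is either unsolved, or `x` does not occur elsewhere, or `t` is a variable
that does not occur elsewhere. -/
theorem solved_cons_cases (h : Solved (Query.eq (Term.var x) t ::ₘ M) (Query.eq (Term.var x) t)) :
    x ∉ vars M ∨ ∃ z, z ≠ x ∧ t = Term.var z ∧ z ∉ vars M := by
  obtain ⟨v, hv, hv'⟩ := h
  have : v ∉ vars M := by
    rw [occ_cons, if_pos hv.mem_freeVars] at hv'
    exact occ_eq_zero.1 (by omega)
  obtain ⟨s, hs, h | h⟩ := hv
  · obtain ⟨rfl, rfl⟩ : x = v ∧ t = s := by simpa using h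
    exact Or.inl this
  · obtain ⟨rfl, rfl⟩ : Term.var x = s ∧ t = Term.var v := by simpa using h
    exact Or.inr ⟨v, by simpa [Term.varFinset] using hs, rfl, this⟩

/-- Afterwards x is isolated, so x = t is solved. If it was not solved before, one solved equation
is gained. If it was, then, as x occurs in `M`, the isolated side was t, a variable: the exchange of
roles left to `stateWeight`. -/
theorem unsolvedCount_subst (hM : ∀ A ∈ M, A.IsEquation ∨ A.IsAtom) (hxt : x ∉ t.varFinset)
    (hx : x ∈ vars M) :
    unsolvedCount (Query.eq (Term.var x) t ::ₘ M.map (Query.subst x t)) <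
        unsolvedCount (Query.eq (Term.var x) t ::ₘ M) ∨
      (unsolvedCount (Query.eq (Term.var x) t ::ₘ M.map (Query.subst x t)) ≤
          unsolvedCount (Query.eq (Term.var x) t ::ₘ M) ∧
        ∃ z, z ≠ x ∧ t = Term.var z ∧ z ∉ vars M) := by
  classical
  set e := Query.eq (Term.var x) t with he
  set M' := M.map (Query.subst x t) with hM'
  have h₁ : (vars (e ::ₘ M')).card ≤ (vars (e ::ₘ M)).card :=
    Finset.card_le_card (vars_cons_map_subst_subset hM (by rfl))
  have h₂ : M.countP (Solved (e ::ₘ M)) ≤ M'.countP (Solved (e ::ₘ M')) :=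
    countP_solved_subst_le hM (by rfl)
  have h₃ : (e ::ₘ M').countP (Solved (e ::ₘ M')) = M'.countP (Solved (e ::ₘ M')) + 1 := by
    refine Multiset.countP_cons_of_pos _ ⟨x, ⟨t, hxt, Or.inl rfl⟩, ?_⟩
    rw [occ_cons, occ_eq_zero.2 (notMem_vars_map_subst hM hxt)]
    simp [he, Query.freeVars]
  have h₄ := countP_solved_le (e ::ₘ M')
  by_cases hs : Solved (e ::ₘ M) e
  · refine Or.inr ⟨?_, (solved_cons_cases hs).resolve_left (not_not_intro hx)⟩
    have h₅ : (e ::ₘ M).countP (Solved (e ::ₘ M)) = M.countP (Solved (e ::ₘ M)) + 1 :=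
      Multiset.countP_cons_of_pos _ hs
    unfold unsolvedCount
    omega
  · have h₅ : (e ::ₘ M).countP (Solved (e ::ₘ M)) = M.countP (Solved (e ::ₘ M)) :=
      Multiset.countP_cons_of_neg _ hs
    left
    unfold unsolvedCount
    omega

/-- The variable x disappears, and the only solved equation that can be lost is x = t. If it was
indeed solved, the count need not drop, but the substitution is then too trivial to change weights.
-/
theorem unsolvedCount_eliminate (hM : ∀ A ∈ M, A.IsEquation ∨ A.IsAtom)
    (hxt : x ∉ t.varFinset) :
    unsolvedCount (Query.tt ::ₘ M.map (Query.subst x t)) <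
        unsolvedCount (Query.eq (Term.var x) t ::ₘ M) ∨
      (unsolvedCount (Query.tt ::ₘ M.map (Query.subst x t)) ≤
          unsolvedCount (Query.eq (Term.var x) t ::ₘ M) ∧
        (x ∉ vars M ∨ ∃ z, t = Term.var z)) := by
  classical
  set e := Query.eq (Term.var x) t with he
  set M' := M.map (Query.subst x t) with hM'
  have h₁ : (vars (Query.tt ::ₘ M')).card < (vars (e ::ₘ M)).card := by
    refine Finset.card_lt_card (Finset.ssubset_iff_subset_ne.2
      ⟨vars_cons_map_subst_subset hM (by simp [Query.freeVars]), fun h => ?_⟩)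
    have hx : x ∈ vars (e ::ₘ M) :=
      mem_vars.2 ⟨e, Multiset.mem_cons_self _ _, by simp [he, Query.freeVars]⟩
    rw [← h] at hx
    obtain ⟨q, hq, hxq⟩ := mem_vars.1 hx
    rcases Multiset.mem_cons.1 hq with rfl | hq
    · simp [Query.freeVars] at hxq
    · exact notMem_vars_map_subst hM hxt (mem_vars.2 ⟨q, hq, hxq⟩)
  have h₂ : M.countP (Solved (e ::ₘ M)) ≤ M'.countP (Solved (Query.tt ::ₘ M')) :=
    countP_solved_subst_le hM (c := Query.tt) (x := x) (t := t) (by simp [Query.freeVars])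
  have h₃ : M'.countP (Solved (Query.tt ::ₘ M')) ≤
      (Query.tt ::ₘ M').countP (Solved (Query.tt ::ₘ M')) :=
    Multiset.countP_le_of_le _ (Multiset.le_cons_self _ _)
  have h₄ := countP_solved_le (Query.tt ::ₘ M')
  have h₆ := countP_solved_le (e ::ₘ M)
  by_cases hs : Solved (e ::ₘ M) e
  · have h₅ : (e ::ₘ M).countP (Solved (e ::ₘ M)) = M.countP (Solved (e ::ₘ M)) + 1 :=
      Multiset.countP_cons_of_pos _ hs
    refine Or.inr ⟨?_, ?_⟩
    · unfold unsolvedCount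
      omega
    · exact (solved_cons_cases hs).imp id fun ⟨z, _, hz, _⟩ => ⟨z, hz⟩
  · have h₅ : (e ::ₘ M).countP (Solved (e ::ₘ M)) = M.countP (Solved (e ::ₘ M)) :=
      Multiset.countP_cons_of_neg _ hs
    left
    unfold unsolvedCount
    omega

end Subst

theorem vars_swap (s t : L.Term ℕ) (M : Multiset (Query L)) :
    vars (Query.eq s t ::ₘ M) = vars (Query.eq t s ::ₘ M) := by
  ext v
  simp [mem_vars, Query.freeVars, or_comm]

theorem occ_swap (s t : L.Term ℕ) (M : Multiset (Query L)) (v : ℕ) :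
    occ (Query.eq s t ::ₘ M) v = occ (Query.eq t s ::ₘ M) v := by
  simp [occ_cons, Query.freeVars, or_comm]

theorem isSide_swap {s t : L.Term ℕ} {v : ℕ} :
    IsSide (Query.eq s t) v ↔ IsSide (Query.eq t s) v := by
  unfold IsSide
  refine exists_congr fun r => and_congr_right fun _ => ?_
  simp only [Query.eq.injEq]
  tauto

theorem unsolvedCount_swap (s t : L.Term ℕ) (M : Multiset (Query L)) :
    unsolvedCount (Query.eq s t ::ₘ M) = unsolvedCount (Query.eq t s ::ₘ M) := by
  have : Solved (Query.eq s t ::ₘ M) = Solved (Query.eq t s ::ₘ M) := by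
    funext q
    simp only [Solved, occ_swap s t]
  have h : Solved (Query.eq t s ::ₘ M) (Query.eq s t) ↔
      Solved (Query.eq t s ::ₘ M) (Query.eq t s) := by
    simp only [Solved, isSide_swap (s := s)]
  simp only [unsolvedCount, vars_swap s t]
  rw [this, Multiset.countP_cons, Multiset.countP_cons]
  split_ifs <;> tauto

/-! ### Weights -/

/-- A size of terms for which variables are strictly smaller than all other terms. -/
def termSize : L.Term ℕ → ℕ
  | .var _ => 1
  | .func _ ts => 2 + ∑ i, termSize (ts i)

/-- The weight of an equation is positive, decreases if a right-hand side that is a variable is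
exchanged with a left-hand side that is not, and exceeds the weights of the equations between the
arguments. -/
def leafWeight : Query L → ℕ
  | .eq s t => 2 * termSize s + termSize t
  | _ => 1

theorem termSize_pos (t : L.Term ℕ) : 0 < termSize t := by
  cases t <;> simp [termSize]

theorem leafWeight_pos (q : Query L) : 0 < leafWeight q := by
  cases q with
  | eq s t =>
    have := termSize_pos s
    simp only [leafWeight]
    omega
  | _ => simp [leafWeight]

theorem termSize_substTerm_var (x z : ℕ) (s : L.Term ℕ) :
    termSize (substTerm x (Term.var z) s) = termSize s := by
  induction s with
  | var y =>
    rw [substTerm_var]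
    split_ifs <;> rfl
  | func f ts ih => simp [substTerm_func, termSize, ih]

theorem leafWeight_subst_var (x z : ℕ) {A : Query L} (hA : A.IsEquation ∨ A.IsAtom) :
    leafWeight (A.subst x (Term.var z)) = leafWeight A := by
  rcases hA with ⟨s, s', rfl⟩ | ⟨n, p, ts, rfl⟩
  · simp [Query.subst, leafWeight, termSize_substTerm_var]
  · rfl

/-- The sum of the weights of the members of `A`. -/
def weight (A : Multiset (Query L)) : ℕ := (A.map leafWeight).sum

theorem weight_cons (q : Query L) (A : Multiset (Query L)) :
    weight (q ::ₘ A) = leafWeight q + weight A := by simp [weight]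

theorem weight_add (A B : Multiset (Query L)) : weight (A + B) = weight A + weight B := by
  simp [weight]

/-- The hypothesis covers the substitutions that may fail to lower `unsolvedCount`: nothing is
replaced, or a variable replaces a variable. -/
theorem weight_map_subst {M : Multiset (Query L)} {x : ℕ} {t : L.Term ℕ}
    (hM : ∀ A ∈ M, A.IsEquation ∨ A.IsAtom) (h : x ∉ vars M ∨ ∃ z, t = Term.var z) :
    weight (M.map (Query.subst x t)) = weight M := by
  rw [weight, Multiset.map_map, weight]
  congr 1
  refine Multiset.map_congr rfl fun A hA => ?_
  rcases h with h | ⟨z, rfl⟩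
  · rw [Function.comp_apply, Query.subst_of_notMem fun hx => h (mem_vars.2 ⟨A, hA, hx⟩)]
  · exact leafWeight_subst_var x z (hM A hA)

/-! ### Orientation of equations between variables -/

/-- The depth of the innermost quantifier binding `v`, for the quantifier prefix `ws` listed from
the inside to the outside; it is `0` if `v` is not bound. -/
def depth (ws : List ℕ) (v : ℕ) : ℕ := ws.length - ws.idxOf v

/-- The prefix is listed innermost first, so members of `ys` precede everything bound further out.
This turns the side condition of `r7` on a final segment into a comparison of depths. -/
theorem depth_lt_depth {ys rest : List ℕ} {x z : ℕ} (hx : x ∈ ys) (hz : z ∉ ys) :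
    depth (ys.reverse ++ rest) z < depth (ys.reverse ++ rest) x := by
  have hx' : x ∈ ys.reverse := by simpa using hx
  have hz' : z ∉ ys.reverse := by simpa using hz
  have := List.idxOf_lt_length_of_mem hx'
  simp only [depth, List.idxOf_append_of_mem hx', List.idxOf_append_of_notMem hz',
    List.length_append]
  omega

open Classical in
/-- The number of equations `z = x` between variables with `x` bound inside the scope of `z`. -/
noncomputable def misoriented (ws : List ℕ) (A : Multiset (Query L)) : ℕ :=
  A.countP fun q => ∃ z x, q = Query.eq (Term.var z) (Term.var x) ∧ depth ws z < depth ws x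

open Classical in
/-- The state of a variable with respect to the equation in which it is isolated. -/
noncomputable def varState (ws : List ℕ) (A : Multiset (Query L)) (v : ℕ) : ℕ :=
  if occ A v ≠ 1 then 1
  else if ∃ w, depth ws v < depth ws w ∧ Query.eq (Term.var v) (Term.var w) ∈ A then 3
  else if ∃ w, w ≠ v ∧ Query.eq (Term.var w) (Term.var v) ∈ A then 2
  else 0

/-- The states of the variables, compared lexicographically with deeper variables first. -/
noncomputable def stateWeight (ws : List ℕ) (A : Multiset (Query L)) : ℕ :=
  ∑ v ∈ vars A, varState ws A v * (3 * (vars A).card + 1) ^ depth ws v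

theorem varState_le_three (ws : List ℕ) (A : Multiset (Query L)) (v : ℕ) :
    varState ws A v ≤ 3 := by
  unfold varState
  split_ifs <;> simp

theorem varState_le_varState {ws : List ℕ} {A A' : Multiset (Query L)} {v : ℕ}
    (ho : occ A' v = occ A v)
    (h₃ : ∀ w, depth ws v < depth ws w → Query.eq (Term.var v) (Term.var w) ∈ A' →
      ∃ w, depth ws v < depth ws w ∧ Query.eq (Term.var v) (Term.var w) ∈ A)
    (h₂ : ∀ w, w ≠ v → Query.eq (Term.var w) (Term.var v) ∈ A' →
      ∃ w, w ≠ v ∧ Query.eq (Term.var w) (Term.var v) ∈ A) :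
    varState ws A' v ≤ varState ws A v := by
  unfold varState
  rw [ho]
  have h₃' : (∃ w, depth ws v < depth ws w ∧ Query.eq (Term.var v) (Term.var w) ∈ A') →
      ∃ w, depth ws v < depth ws w ∧ Query.eq (Term.var v) (Term.var w) ∈ A :=
    fun ⟨w, h, h'⟩ => h₃ w h h'
  have h₂' : (∃ w, w ≠ v ∧ Query.eq (Term.var w) (Term.var v) ∈ A') →
      ∃ w, w ≠ v ∧ Query.eq (Term.var w) (Term.var v) ∈ A :=
    fun ⟨w, h, h'⟩ => h₂ w h h'
  split_ifs <;> first | omega | tauto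

/-- Digits at most 3 in base 3|V| + 1: all positions of smaller depth together cannot outweigh one
unit at the depth of the pivot p. -/
theorem sum_pow_lt_sum_pow {V : Finset ℕ} {D f g : ℕ → ℕ} {p : ℕ} (hp : p ∈ V)
    (hlt : g p < f p) (hle : ∀ v ∈ V, D p ≤ D v → g v ≤ f v) (hg : ∀ v, g v ≤ 3) :
    ∑ v ∈ V, g v * (3 * V.card + 1) ^ D v < ∑ v ∈ V, f v * (3 * V.card + 1) ^ D v := by
  set K := 3 * V.card + 1 with hK
  -- `c` bounds the contribution of one shallower variable; at depth 0 there is none, so 0 serves.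
  obtain ⟨c, hc, hlow⟩ : ∃ c, V.card * c < K ^ D p ∧ ∀ v, D v < D p → 3 * K ^ D v ≤ c := by
    rcases Nat.eq_zero_or_pos (D p) with h0 | h0
    · exact ⟨0, by simp [h0], fun v hv => by omega⟩
    · refine ⟨3 * K ^ (D p - 1), ?_, fun v hv => ?_⟩
      · have h1 : K ^ D p = K * K ^ (D p - 1) := by
          rw [← pow_succ', Nat.sub_add_cancel h0]
        have h2 : 0 < K ^ (D p - 1) := Nat.pow_pos (by omega)
        have h3 : K * K ^ (D p - 1) = V.card * (3 * K ^ (D p - 1)) + K ^ (D p - 1) := by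
          rw [hK]
          ring
        omega
      · exact Nat.mul_le_mul_left _ (Nat.pow_le_pow_right (by omega) (by omega))
  have h₁ : ∑ v ∈ V.erase p, g v * K ^ D v ≤ ∑ v ∈ V.erase p, (f v * K ^ D v + c) := by
    refine Finset.sum_le_sum fun v hv => ?_
    rcases Nat.lt_or_ge (D v) (D p) with h | h
    · exact ((Nat.mul_le_mul_right _ (hg v)).trans (hlow v h)).trans (Nat.le_add_left _ _)
    · exact (Nat.mul_le_mul_right _ (hle v (Finset.mem_of_mem_erase hv) h)).trans
        (Nat.le_add_right _ _)
  rw [Finset.sum_add_distrib, Finset.sum_const, smul_eq_mul] at h₁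
  have h₂ : (V.erase p).card * c ≤ V.card * c :=
    Nat.mul_le_mul_right _ (Finset.card_le_card (Finset.erase_subset _ _))
  have h₃ : g p * K ^ D p + K ^ D p ≤ f p * K ^ D p := by
    rw [← Nat.succ_mul]
    exact Nat.mul_le_mul_right _ hlt
  rw [← Finset.add_sum_erase V _ hp, ← Finset.add_sum_erase V (fun v => f v * K ^ D v) hp]
  omega

theorem stateWeight_lt_stateWeight {ws : List ℕ} {A A' : Multiset (Query L)} {p : ℕ}
    (hV : vars A' = vars A) (hp : p ∈ vars A) (hlt : varState ws A' p < varState ws A p)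
    (hle : ∀ v, depth ws p ≤ depth ws v → varState ws A' v ≤ varState ws A v) :
    stateWeight ws A' < stateWeight ws A := by
  unfold stateWeight
  rw [hV]
  exact sum_pow_lt_sum_pow hp hlt (fun v _ => hle v) (varState_le_three ws A')

section Swap

variable {ws : List ℕ} {M : Multiset (Query L)} {x z : ℕ}

/-- If isolated in the equation, x passes from state 2 to 0, and z from 3 to 2. Variables that are
not isolated keep state 1, and no other variable sees a changed equation. -/
theorem varState_swap_le (h : depth ws z < depth ws x) (v : ℕ) :
    varState ws (Query.eq (Term.var x) (Term.var z) ::ₘ M) v ≤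
        varState ws (Query.eq (Term.var z) (Term.var x) ::ₘ M) v ∧
      ((v = x ∨ v = z) → occ (Query.eq (Term.var z) (Term.var x) ::ₘ M) v = 1 →
        varState ws (Query.eq (Term.var x) (Term.var z) ::ₘ M) v <
          varState ws (Query.eq (Term.var z) (Term.var x) ::ₘ M) v) := by
  have hzx : z ≠ x := fun e => by simp [e] at h
  have ho := occ_swap (Term.var x) (Term.var z) M v
  by_cases hv : v = x ∨ v = z
  · suffices H : occ (Query.eq (Term.var z) (Term.var x) ::ₘ M) v = 1 →
        varState ws (Query.eq (Term.var x) (Term.var z) ::ₘ M) v <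
          varState ws (Query.eq (Term.var z) (Term.var x) ::ₘ M) v by
      refine ⟨?_, fun _ => H⟩
      by_cases h1 : occ (Query.eq (Term.var z) (Term.var x) ::ₘ M) v = 1
      · exact (H h1).le
      · unfold varState
        simp [ho, h1]
    intro h1
    have hvM : v ∉ vars M := by
      rw [occ_cons, if_pos (by rcases hv with rfl | rfl <;> simp [Query.freeVars])] at h1
      exact occ_eq_zero.1 (by omega)
    have hl : ∀ w, Query.eq (Term.var v) (Term.var w) ∉ M := fun w hw =>
      hvM (mem_vars.2 ⟨_, hw, by simp [Query.freeVars]⟩)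
    have hr : ∀ w, Query.eq (Term.var w) (Term.var v) ∉ M := fun w hw =>
      hvM (mem_vars.2 ⟨_, hw, by simp [Query.freeVars]⟩)
    unfold varState
    rw [ho]
    rcases hv with rfl | rfl
    · have a₁ : ¬ ∃ w, depth ws v < depth ws w ∧ Query.eq (Term.var v) (Term.var w) ∈
          Query.eq (Term.var v) (Term.var z) ::ₘ M := by
        rintro ⟨w, hw, hw'⟩
        simp only [Multiset.mem_cons, Query.eq.injEq, Term.var.injEq, true_and, hl,
          or_false] at hw'
        subst hw'
        omega
      have a₂ : ¬ ∃ w, w ≠ v ∧ Query.eq (Term.var w) (Term.var v) ∈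
          Query.eq (Term.var v) (Term.var z) ::ₘ M := by
        rintro ⟨w, hw, hw'⟩
        simp only [Multiset.mem_cons, Query.eq.injEq, Term.var.injEq, hr, or_false] at hw'
        exact hw hw'.1
      have a₃ : ∃ w, w ≠ v ∧ Query.eq (Term.var w) (Term.var v) ∈
          Query.eq (Term.var z) (Term.var v) ::ₘ M := ⟨z, hzx, by simp⟩
      rw [if_neg (not_not_intro h1), if_neg (not_not_intro h1), if_neg a₁, if_neg a₂]
      split_ifs <;> simp
    · have a₁ : ¬ ∃ w, depth ws v < depth ws w ∧ Query.eq (Term.var v) (Term.var w) ∈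
          Query.eq (Term.var x) (Term.var v) ::ₘ M := by
        rintro ⟨w, hw, hw'⟩
        simp only [Multiset.mem_cons, Query.eq.injEq, Term.var.injEq, hl, or_false] at hw'
        exact hzx hw'.1
      have a₃ : ∃ w, depth ws v < depth ws w ∧ Query.eq (Term.var v) (Term.var w) ∈
          Query.eq (Term.var v) (Term.var x) ::ₘ M := ⟨x, h, by simp⟩
      rw [if_neg (not_not_intro h1), if_neg (not_not_intro h1), if_neg a₁, if_pos a₃]
      split_ifs <;> simp
  · refine ⟨?_, fun h => absurd h hv⟩
    rw [not_or] at hv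
    refine varState_le_varState ho (fun w hw hm => ⟨w, hw, ?_⟩) (fun w hw hm => ⟨w, hw, ?_⟩) <;>
    simp only [Multiset.mem_cons, Query.eq.injEq, Term.var.injEq, hv, false_and, and_false,
      false_or] at hm ⊢ <;> exact hm

theorem stateWeight_swap (h : depth ws z < depth ws x) :
    stateWeight ws (Query.eq (Term.var x) (Term.var z) ::ₘ M) ≤
      stateWeight ws (Query.eq (Term.var z) (Term.var x) ::ₘ M) := by
  unfold stateWeight
  rw [vars_swap (Term.var x)]
  exact Finset.sum_le_sum fun v _ => Nat.mul_le_mul_right _ (varState_swap_le h v).1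

theorem misoriented_swap (h : depth ws z < depth ws x) :
    misoriented ws (Query.eq (Term.var x) (Term.var z) ::ₘ M) <
      misoriented ws (Query.eq (Term.var z) (Term.var x) ::ₘ M) := by
  classical
  unfold misoriented
  rw [Multiset.countP_cons_of_neg, Multiset.countP_cons_of_pos]
  · omega
  · exact ⟨z, x, rfl, h⟩
  · rintro ⟨a, b, hab, h'⟩
    simp only [Query.eq.injEq, Term.var.injEq] at hab
    obtain ⟨rfl, rfl⟩ := hab
    omega

end Swap

theorem substTerm_var_eq_var {x z v : ℕ} {s : L.Term ℕ}
    (h : substTerm x (Term.var z) s = Term.var v) :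
    (s = Term.var v ∧ v ≠ x) ∨ (s = Term.var x ∧ v = z) := by
  cases s with
  | var y =>
    rw [substTerm_var] at h
    split_ifs at h with hy
    · subst hy
      exact Or.inr ⟨rfl, (Term.var.inj h).symm⟩
    · obtain rfl := Term.var.inj h
      exact Or.inl ⟨rfl, hy⟩
  | func f ts => simp [substTerm_func] at h

theorem exists_of_eq_mem_map_subst {M : Multiset (Query L)} {x z v w : ℕ}
    (hM : ∀ A ∈ M, A.IsEquation ∨ A.IsAtom)
    (h : Query.eq (Term.var v) (Term.var w) ∈ M.map (Query.subst x (Term.var z))) :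
    ∃ v' w', Query.eq (Term.var v') (Term.var w') ∈ M ∧
      ((v' = v ∧ v ≠ x) ∨ (v' = x ∧ v = z)) ∧ ((w' = w ∧ w ≠ x) ∨ (w' = x ∧ w = z)) := by
  obtain ⟨A, hA, h⟩ := Multiset.mem_map.1 h
  rcases hM A hA with ⟨s, s', rfl⟩ | ⟨n, p, ts, rfl⟩
  · simp only [Query.subst, Query.eq.injEq] at h
    rcases substTerm_var_eq_var h.1 with ⟨rfl, h1⟩ | ⟨rfl, h1⟩ <;>
    rcases substTerm_var_eq_var h.2 with ⟨rfl, h2⟩ | ⟨rfl, h2⟩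
    · exact ⟨_, _, hA, Or.inl ⟨rfl, h1⟩, Or.inl ⟨rfl, h2⟩⟩
    · exact ⟨_, _, hA, Or.inl ⟨rfl, h1⟩, Or.inr ⟨rfl, h2⟩⟩
    · exact ⟨_, _, hA, Or.inr ⟨rfl, h1⟩, Or.inl ⟨rfl, h2⟩⟩
    · exact ⟨_, _, hA, Or.inr ⟨rfl, h1⟩, Or.inr ⟨rfl, h2⟩⟩
  · simp [Query.subst] at h

/-- Before, z is isolated on the right (state 2) and x is not isolated (state 1). Afterwards z has
state 1, while x has state 0, or 3 if z is deeper than x. In either case the deepest relevant change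
is a decrease. -/
theorem stateWeight_subst_var (ws : List ℕ) {M : Multiset (Query L)} {x z : ℕ}
    (hM : ∀ A ∈ M, A.IsEquation ∨ A.IsAtom) (hzx : z ≠ x) (hx : x ∈ vars M) (hz : z ∉ vars M) :
    stateWeight ws (Query.eq (Term.var x) (Term.var z) ::ₘ M.map (Query.subst x (Term.var z))) <
      stateWeight ws (Query.eq (Term.var x) (Term.var z) ::ₘ M) := by
  set e : Query L := Query.eq (Term.var x) (Term.var z) with he
  set M' := M.map (Query.subst x (Term.var z)) with hM'
  have hxz' : x ∉ (Term.var z : L.Term ℕ).varFinset := by simp [Term.varFinset, Ne.symm hzx]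
  have hxe : x ∈ e.freeVars := by simp [he, Query.freeVars]
  have hze : z ∈ e.freeVars := by simp [he, Query.freeVars]
  have hxM' : x ∉ vars M' := notMem_vars_map_subst hM hxz'
  have hzM' : z ∈ vars M' := by
    obtain ⟨A, hA, hxA⟩ := mem_vars.1 hx
    exact mem_vars.2 ⟨_, Multiset.mem_map_of_mem _ hA,
      (mem_freeVars_subst (hM A hA)).2 (Or.inr ⟨hxA, by simp [Term.varFinset]⟩)⟩
  have hV : vars (e ::ₘ M') = vars (e ::ₘ M) := by
    refine Finset.Subset.antisymm (vars_cons_map_subst_subset hM (by rfl)) fun v hv => ?_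
    obtain ⟨q, hq, hv⟩ := mem_vars.1 hv
    rcases Multiset.mem_cons.1 hq with rfl | hq
    · exact mem_vars.2 ⟨_, Multiset.mem_cons_self _ _, hv⟩
    · by_cases hvx : v = x
      · exact mem_vars.2 ⟨e, Multiset.mem_cons_self _ _, hvx ▸ hxe⟩
      · exact mem_vars.2 ⟨_, Multiset.mem_cons_of_mem (Multiset.mem_map_of_mem _ hq),
          (mem_freeVars_subst (hM q hq)).2 (Or.inl ⟨hvx, hv⟩)⟩
  have hx_old : varState ws (e ::ₘ M) x = 1 := by
    have := occ_pos.2 hx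
    unfold varState
    rw [if_pos]
    rw [occ_cons, if_pos hxe]
    omega
  have hz_new : varState ws (e ::ₘ M') z = 1 := by
    have := occ_pos.2 hzM'
    unfold varState
    rw [if_pos]
    rw [occ_cons, if_pos hze]
    omega
  have hz_old : varState ws (e ::ₘ M) z = 2 := by
    have h1 : occ (e ::ₘ M) z = 1 := by rw [occ_cons, occ_eq_zero.2 hz, if_pos hze]
    have a₁ : ¬ ∃ w, depth ws z < depth ws w ∧ Query.eq (Term.var z) (Term.var w) ∈ e ::ₘ M := by
      rintro ⟨w, -, hw⟩
      rcases Multiset.mem_cons.1 hw with h | h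
      · simp only [he, Query.eq.injEq, Term.var.injEq] at h
        exact hzx h.1
      · exact hz (mem_vars.2 ⟨_, h, by simp [Query.freeVars]⟩)
    have a₂ : ∃ w, w ≠ z ∧ Query.eq (Term.var w) (Term.var z) ∈ e ::ₘ M :=
      ⟨x, hzx.symm, Multiset.mem_cons_self _ _⟩
    unfold varState
    rw [if_neg (not_not_intro h1), if_neg a₁, if_pos a₂]
  have hx_new : ¬ depth ws x < depth ws z → varState ws (e ::ₘ M') x = 0 := by
    intro hd
    have h1 : occ (e ::ₘ M') x = 1 := by rw [occ_cons, occ_eq_zero.2 hxM', if_pos hxe]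
    have a₁ : ¬ ∃ w, depth ws x < depth ws w ∧
        Query.eq (Term.var x) (Term.var w) ∈ e ::ₘ M' := by
      rintro ⟨w, hw', hw⟩
      rcases Multiset.mem_cons.1 hw with h | h
      · simp only [he, Query.eq.injEq, Term.var.injEq, true_and] at h
        exact hd (h ▸ hw')
      · exact hxM' (mem_vars.2 ⟨_, h, by simp [Query.freeVars]⟩)
    have a₂ : ¬ ∃ w, w ≠ x ∧ Query.eq (Term.var w) (Term.var x) ∈ e ::ₘ M' := by
      rintro ⟨w, hw', hw⟩
      rcases Multiset.mem_cons.1 hw with h | h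
      · simp only [he, Query.eq.injEq, Term.var.injEq] at h
        exact hw' h.1
      · exact hxM' (mem_vars.2 ⟨_, h, by simp [Query.freeVars]⟩)
    unfold varState
    rw [if_neg (not_not_intro h1), if_neg a₁, if_neg a₂]
  -- Turning v = x into v = z can raise v to state 3 only if z is deeper than both x and v. The
  -- excluded variables are then shallower than the pivot z.
  have hother : ∀ v, v ≠ x → v ≠ z → ¬ (depth ws x < depth ws z ∧ depth ws v < depth ws z) →
      varState ws (e ::ₘ M') v ≤ varState ws (e ::ₘ M) v := by
    intro v hvx hvz hd
    have hve : v ∉ e.freeVars := by simp [he, Query.freeVars, hvx, hvz]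
    refine varState_le_varState ?_ (fun w hw hm => ?_) (fun w hw hm => ?_)
    · rw [occ_cons, occ_cons, occ_map_subst hM hvx (by simp [Term.varFinset, hvz])]
    · rcases Multiset.mem_cons.1 hm with h | h
      · simp only [he, Query.eq.injEq, Term.var.injEq] at h
        exact absurd h.1 hvx
      · obtain ⟨v', w', hmem, ⟨rfl, -⟩ | ⟨-, h1⟩, h2⟩ := exists_of_eq_mem_map_subst hM h
        · refine ⟨w', ?_, Multiset.mem_cons_of_mem hmem⟩
          rcases h2 with ⟨rfl, -⟩ | ⟨rfl, rfl⟩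
          · exact hw
          · omega
        · exact absurd h1 hvz
    · rcases Multiset.mem_cons.1 hm with h | h
      · simp only [he, Query.eq.injEq, Term.var.injEq] at h
        exact absurd h.2 hvz
      · obtain ⟨w', v', hmem, h2, ⟨rfl, -⟩ | ⟨-, h1⟩⟩ := exists_of_eq_mem_map_subst hM h
        · refine ⟨w', ?_, Multiset.mem_cons_of_mem hmem⟩
          rcases h2 with ⟨rfl, -⟩ | ⟨rfl, -⟩
          · exact hw
          · exact hvx.symm
        · exact absurd h1 hvz
  -- If z is deeper, it is the pivot and its drop from 2 to 1 outweighs a rise of x. Otherwise x is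
  -- the pivot and drops from 1 to 0.
  by_cases hd : depth ws x < depth ws z
  · refine stateWeight_lt_stateWeight hV (p := z)
      (mem_vars.2 ⟨e, Multiset.mem_cons_self _ _, hze⟩) (by omega) fun v hv => ?_
    by_cases hvz : v = z
    · subst hvz
      omega
    · exact hother v (fun e => by subst e; omega) hvz (by omega)
  · refine stateWeight_lt_stateWeight hV (p := x)
      (mem_vars.2 ⟨e, Multiset.mem_cons_self _ _, hxe⟩) (by rw [hx_new hd]; omega) fun v hv => ?_
    by_cases hvz : v = z
    · subst hvz
      omega
    · by_cases hvx : v = x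
      · subst hvx
        rw [hx_new hd]
        omega
      · exact hother v hvx hvz (by omega)

/-! ### Measures of queries -/

namespace Query

/-- The number of quantifiers. -/
def quants : Query L → ℕ
  | and P R => P.quants + R.quants
  | ex _ P => P.quants + 1
  | _ => 0

/-- The number of pairs of quantifiers neither of which is in the scope of the other. -/
def parallel : Query L → ℕ
  | and P R => P.parallel + R.parallel + P.quants * R.quants
  | ex _ P => P.parallel
  | _ => 0

/-- The total weight of the leaves that are not in the scope of a quantifier. -/
def openWeight : Query L → ℕ
  | and P R => P.openWeight + R.openWeight
  | ex _ _ => 0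
  | q => leafWeight q

/-- The sum, over all quantifiers, of the weights of the leaves outside of its scope that are in
the scope of fewer quantifiers. -/
def crossing : Query L → ℕ
  | and P R => P.crossing + R.crossing + P.openWeight * R.quants + R.openWeight * P.quants
  | ex _ P => P.crossing
  | _ => 0

/-- The multiset of all subqueries that are not built by a conjunction or a quantifier. -/
def leaves : Query L → Multiset (Query L)
  | and P R => P.leaves + R.leaves
  | ex _ P => P.leaves
  | q => {q}

/-- The sum of the values of `F` over the quantifier-free subqueries directly under a quantifier;
`F` is applied to the quantifier prefix, innermost first, and the leaves. -/
def blockSum (F : List ℕ → Multiset (Query L) → ℕ) : List ℕ → Query L → ℕ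
  | _, and P R => blockSum F [] P + blockSum F [] R
  | ws, ex x P => if P.quants = 0 then F (x :: ws) P.leaves else blockSum F (x :: ws) P
  | _, _ => 0

open Classical in
/-- The number of pairs of an atom and an equation to the right of it in the same conjunction. -/
noncomputable def inversions : Query L → ℕ
  | and P R => P.inversions + R.inversions + P.card * R.leaves.countP IsEquation
  | ex _ P => P.inversions
  | _ => 0

theorem parallel_eq_zero {Q : Query L} (h : Q.quants = 0) : Q.parallel = 0 := by
  induction Q with
  | and P R ihP ihR =>
    simp only [quants, Nat.add_eq_zero_iff] at h
    simp [parallel, ihP h.1, ihR h.2, h]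
  | ex x P => simp [quants] at h
  | _ => rfl

theorem crossing_eq_zero {Q : Query L} (h : Q.quants = 0) : Q.crossing = 0 := by
  induction Q with
  | and P R ihP ihR =>
    simp only [quants, Nat.add_eq_zero_iff] at h
    simp [crossing, ihP h.1, ihR h.2, h]
  | ex x P => simp [quants] at h
  | _ => rfl

theorem blockSum_eq_zero {Q : Query L} (F : List ℕ → Multiset (Query L) → ℕ) (ws : List ℕ)
    (h : Q.quants = 0) : blockSum F ws Q = 0 := by
  induction Q generalizing ws with
  | and P R ihP ihR =>
    simp only [quants, Nat.add_eq_zero_iff] at h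
    simp [blockSum, ihP _ h.1, ihR _ h.2]
  | ex x P => simp [quants] at h
  | _ => rfl

theorem openWeight_eq_weight {Q : Query L} (h : Q.quants = 0) :
    Q.openWeight = weight Q.leaves := by
  induction Q with
  | and P R ihP ihR =>
    simp only [quants, Nat.add_eq_zero_iff] at h
    simp [openWeight, leaves, weight_add, ihP h.1, ihR h.2]
  | ex x P => simp [quants] at h
  | _ => simp [openWeight, leaves, weight]

theorem openWeight_pos {Q : Query L} (h : Q.quants = 0) : 0 < Q.openWeight := by
  induction Q with
  | and P R ihP ihR =>
    simp only [quants, Nat.add_eq_zero_iff] at h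
    have := ihP h.1
    simp only [openWeight]
    omega
  | ex x P => simp [quants] at h
  | _ => exact leafWeight_pos _

theorem quants_exs (ys : List ℕ) (Q : Query L) : (exs ys Q).quants = Q.quants + ys.length := by
  induction ys with
  | nil => rfl
  | cons y ys ih => rw [exs_cons, quants, ih, List.length_cons, add_assoc]

theorem parallel_exs (ys : List ℕ) (Q : Query L) : (exs ys Q).parallel = Q.parallel := by
  induction ys with
  | nil => rfl
  | cons y ys ih => exact ih

theorem crossing_exs (ys : List ℕ) (Q : Query L) : (exs ys Q).crossing = Q.crossing := by
  induction ys with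
  | nil => rfl
  | cons y ys ih => exact ih

theorem leaves_exs (ys : List ℕ) (Q : Query L) : (exs ys Q).leaves = Q.leaves := by
  induction ys with
  | nil => rfl
  | cons y ys ih => exact ih

theorem openWeight_exs {ys : List ℕ} (h : ys ≠ []) (Q : Query L) : (exs ys Q).openWeight = 0 := by
  cases ys with
  | nil => exact absurd rfl h
  | cons y ys => rfl

theorem blockSum_exs (F : List ℕ → Multiset (Query L) → ℕ) {ys : List ℕ} (h : ys ≠ [])
    (ws : List ℕ) {Q : Query L} (hQ : Q.quants = 0) :
    blockSum F ws (exs ys Q) = F (ys.reverse ++ ws) Q.leaves := by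
  induction ys generalizing ws with
  | nil => exact absurd rfl h
  | cons y ys ih =>
    rw [exs_cons, blockSum, quants_exs, leaves_exs, hQ]
    cases ys with
    | nil => simp
    | cons z zs =>
      rw [if_neg (by simp), ih (by simp)]
      simp

/-- Deleting `tt` can remove the conjunction at which the prefix is reset, changing the prefix of a
block; a function of the leaves alone does not notice. -/
theorem blockSum_const (G : Multiset (Query L) → ℕ) (ws ws' : List ℕ) (Q : Query L) :
    blockSum (fun _ => G) ws Q = blockSum (fun _ => G) ws' Q := by
  induction Q generalizing ws ws' with
  | ex x P ih => rw [blockSum, blockSum, ih (x :: ws) (x :: ws')]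
  | _ => rfl

theorem leaves_conj {l : List (Query L)} (h : l ≠ []) :
    (conj l).leaves = (l.map leaves).sum := by
  induction l with
  | nil => exact absurd rfl h
  | cons A l ih =>
    cases l with
    | nil => simp [conj]
    | cons B l =>
      rw [conj_cons (by simp), leaves, ih (by simp)]
      simp

theorem quants_conj {l : List (Query L)} (h : ∀ A ∈ l, A.quants = 0) : (conj l).quants = 0 := by
  induction l with
  | nil => rfl
  | cons A l ih =>
    have := ih fun B hB => h B (by simp [hB])
    cases l with
    | nil => exact h A (by simp)
    | cons B l => rw [conj_cons (by simp), quants, h A (by simp), this]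

theorem leaves_of_isEquation_or_isAtom {A : Query L} (h : A.IsEquation ∨ A.IsAtom) :
    A.leaves = {A} := by
  rcases h with ⟨s, t, rfl⟩ | ⟨n, p, ts, rfl⟩ <;> rfl

theorem quants_of_isEquation_or_isAtom {A : Query L} (h : A.IsEquation ∨ A.IsAtom) :
    A.quants = 0 := by
  rcases h with ⟨s, t, rfl⟩ | ⟨n, p, ts, rfl⟩ <;> rfl

theorem sum_map_leaves {l : List (Query L)} (h : ∀ A ∈ l, A.IsEquation ∨ A.IsAtom) :
    (l.map leaves).sum = (l : Multiset (Query L)) := by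
  induction l with
  | nil => rfl
  | cons A l ih =>
    rw [List.map_cons, List.sum_cons, ih fun B hB => h B (by simp [hB]),
      leaves_of_isEquation_or_isAtom (h A (by simp)), Multiset.singleton_add, Multiset.cons_coe]

theorem leaves_conj_insert {Q₁ Q₂ : List (Query L)} {e : Query L}
    (h : ∀ A ∈ Q₁ ++ Q₂, A.IsEquation ∨ A.IsAtom) (he : e.leaves = {e}) :
    (conj (Q₁ ++ e :: Q₂)).leaves = e ::ₘ ((Q₁ ++ Q₂ : List (Query L)) : Multiset (Query L)) := by
  rw [leaves_conj (by simp), List.map_append, List.map_cons, List.sum_append, List.sum_cons, he,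
    sum_map_leaves fun A hA => h A (by simp [hA]), sum_map_leaves fun A hA => h A (by simp [hA]),
    ← Multiset.coe_add, ← Multiset.singleton_add]
  abel

theorem quants_conj_insert {Q₁ Q₂ : List (Query L)} {e : Query L}
    (h : ∀ A ∈ Q₁ ++ Q₂, A.IsEquation ∨ A.IsAtom) (he : e.quants = 0) :
    (conj (Q₁ ++ e :: Q₂)).quants = 0 := by
  refine quants_conj fun A hA => ?_
  simp only [List.mem_append, List.mem_cons] at hA h
  rcases hA with hA | rfl | hA
  · exact quants_of_isEquation_or_isAtom (h A (Or.inl hA))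
  · exact he
  · exact quants_of_isEquation_or_isAtom (h A (Or.inr hA))

end Query

open Query

/-- Equality of all measures except `Query.inversions`. -/
structure SameProfile (P P' : Query L) : Prop where
  quants : P'.quants = P.quants
  parallel : P'.parallel = P.parallel
  openWeight : P'.openWeight = P.openWeight
  crossing : P'.crossing = P.crossing
  card : P'.card = P.card
  leaves : P'.leaves = P.leaves
  blockSum : ∀ F ws, Query.blockSum F ws P' = Query.blockSum F ws P

namespace SameProfile

theorem refl (P : Query L) : SameProfile P P := ⟨rfl, rfl, rfl, rfl, rfl, rfl, fun _ _ => rfl⟩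

theorem symm {P P' : Query L} (h : SameProfile P P') : SameProfile P' P :=
  ⟨h.1.symm, h.2.symm, h.3.symm, h.4.symm, h.5.symm, h.6.symm, fun F ws => (h.7 F ws).symm⟩

theorem trans {P P' P'' : Query L} (h : SameProfile P P') (h' : SameProfile P' P'') :
    SameProfile P P'' :=
  ⟨h'.1.trans h.1, h'.2.trans h.2, h'.3.trans h.3, h'.4.trans h.4, h'.5.trans h.5,
    h'.6.trans h.6, fun F ws => (h'.7 F ws).trans (h.7 F ws)⟩

theorem and {P P' R R' : Query L} (h : SameProfile P P') (h' : SameProfile R R') :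
    SameProfile (Query.and P R) (Query.and P' R') := by
  constructor <;> simp [Query.quants, Query.parallel, Query.openWeight, Query.crossing,
    Query.card, Query.leaves, Query.blockSum, h.1, h.2, h.3, h.4, h.5, h.6, h.7, h'.1, h'.2,
    h'.3, h'.4, h'.5, h'.6, h'.7]

theorem ex (x : ℕ) {P P' : Query L} (h : SameProfile P P') :
    SameProfile (Query.ex x P) (Query.ex x P') := by
  constructor <;> simp [Query.quants, Query.parallel, Query.openWeight, Query.crossing,
    Query.card, Query.leaves, Query.blockSum, h.1, h.2, h.4, h.5, h.6, h.7]

theorem of_assocRule {P P' : Query L} (h : AssocRule P P') : SameProfile P P' := by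
  obtain ⟨P, Q, R⟩ := h
  constructor <;> simp only [Query.quants, Query.parallel, Query.openWeight, Query.crossing,
    Query.card, Query.leaves, Query.blockSum] <;> intros <;>
    first | ring1 | exact (add_assoc _ _ _).symm

end SameProfile

/-- At a conjunction every measure is a sum of the values of both sides and of products of additive
quantities, so it does not depend on the bracketing. -/
theorem sameProfile_of_assocEq {P P' : Query L} (h : AssocEq P P') :
    SameProfile P P' ∧ P'.inversions = P.inversions := by
  induction h with
  | rel _ _ h =>
    induction h with
    | here h =>
      refine ⟨SameProfile.of_assocRule h, ?_⟩
      obtain ⟨P, Q, R⟩ := h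
      simp only [Query.inversions, Query.card, Query.leaves, Multiset.countP_add]
      ring
    | andLeft R _ ih =>
      exact ⟨ih.1.and (SameProfile.refl R), by simp [Query.inversions, ih.2, ih.1.card]⟩
    | andRight R _ ih =>
      exact ⟨(SameProfile.refl R).and ih.1, by simp [Query.inversions, ih.2, ih.1.leaves]⟩
    | ex x _ ih => exact ⟨ih.1.ex x, by simp [Query.inversions, ih.2]⟩
  | refl P => exact ⟨SameProfile.refl P, rfl⟩
  | symm _ _ _ ih => exact ⟨ih.1.symm, ih.2.symm⟩
  | trans _ _ _ _ _ ih ih' => exact ⟨ih.1.trans ih'.1, ih'.2.trans ih.2⟩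

/-! ### Prenexing -/

/-- Quantifiers are moved out of conjunctions. -/
structure Prenexes (P P' : Query L) : Prop where
  quants : P'.quants = P.quants
  openWeight : P'.openWeight ≤ P.openWeight
  parallel : P'.parallel < P.parallel ∨
    (P'.parallel = P.parallel ∧ P'.crossing < P.crossing)

namespace Prenexes

/-- `openWeight` is part of the structure because it multiplies the quantifiers of `R` in
`crossing`; without its bound the decrease would not pass to the context. -/
theorem andLeft (R : Query L) {P P' : Query L} (h : Prenexes P P') :
    Prenexes (Query.and P R) (Query.and P' R) := by
  have := Nat.mul_le_mul_right R.quants h.openWeight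
  have := h.parallel
  have := h.openWeight
  constructor <;> simp only [Query.quants, Query.parallel, Query.openWeight, Query.crossing,
    h.quants] <;> omega

theorem andRight (R : Query L) {P P' : Query L} (h : Prenexes P P') :
    Prenexes (Query.and R P) (Query.and R P') := by
  have := Nat.mul_le_mul_right R.quants h.openWeight
  have := h.parallel
  have := h.openWeight
  constructor <;> simp only [Query.quants, Query.parallel, Query.openWeight, Query.crossing,
    h.quants] <;> omega

theorem ex (x : ℕ) {P P' : Query L} (h : Prenexes P P') :
    Prenexes (Query.ex x P) (Query.ex x P') :=
  ⟨by simp [Query.quants, h.quants], le_rfl, h.parallel⟩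

end Prenexes

/-- Equality of the measures that do not depend on the names of the variables. -/
structure SameShape (P P' : Query L) : Prop where
  quants : P'.quants = P.quants
  parallel : P'.parallel = P.parallel
  openWeight : P'.openWeight = P.openWeight
  crossing : P'.crossing = P.crossing

theorem sameShape_subst_var (x y : ℕ) (Q : Query L) :
    SameShape Q (Q.subst x (Term.var y)) := by
  induction Q with
  | and P R ihP ihR =>
    constructor <;> simp [subst, quants, parallel, openWeight, crossing, ihP.1, ihP.2, ihP.3,
      ihP.4, ihR.1, ihR.2, ihR.3, ihR.4]
  | ex z P ih =>
    constructor <;> simp only [subst] <;> split_ifs <;>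
      simp [quants, parallel, openWeight, crossing, ih.1, ih.2, ih.4]
  | eq s t => exact ⟨rfl, rfl, leafWeight_subst_var x y (Or.inl ⟨s, t, rfl⟩), rfl⟩
  | _ => exact ⟨rfl, rfl, rfl, rfl⟩

theorem sameShape_of_variant {P P' : Query L} (h : Variant P P') : SameShape P P' := by
  have key : ∀ {P P' : Query L}, Everywhere RenameRule P P' → SameShape P P' := by
    intro P P' h
    induction h with
    | here h =>
      obtain ⟨x, y, G, -, -⟩ := h
      have := sameShape_subst_var x y G
      constructor <;> simp [quants, parallel, openWeight, crossing, this.1, this.2, this.4]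
    | andLeft R _ ih =>
      constructor <;> simp [quants, parallel, openWeight, crossing, ih.1, ih.2, ih.3, ih.4]
    | andRight R _ ih =>
      constructor <;> simp [quants, parallel, openWeight, crossing, ih.1, ih.2, ih.3, ih.4]
    | ex x _ ih =>
      constructor <;> simp [quants, parallel, openWeight, crossing, ih.1, ih.2, ih.4]
  induction h with
  | refl => exact ⟨rfl, rfl, rfl, rfl⟩
  | tail _ h ih =>
    have := key h
    exact ⟨this.1.trans ih.1, this.2.trans ih.2, this.3.trans ih.3, this.4.trans ih.4⟩

/-- If a moved quantifier faces another quantifier, parallel pairs are lost. Otherwise the other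
conjunct is quantifier-free; its positive open weight enters the scope of the moved quantifiers and
is no longer counted against them. -/
theorem prenexes_exs {zs₁ zs₂ : List ℕ} (R₁ R₂ : Query L) (h : zs₁ ≠ [] ∨ zs₂ ≠ []) :
    Prenexes (Query.and (exs zs₁ R₁) (exs zs₂ R₂)) (exs zs₁ (exs zs₂ (Query.and R₁ R₂))) := by
  refine ⟨by simp only [quants_exs, quants]; omega, ?_, ?_⟩
  · rw [← exs_append, openWeight_exs (by simpa [or_iff_not_imp_left] using h)]
    exact Nat.zero_le _
  · simp only [parallel_exs, crossing_exs, parallel, crossing, quants_exs]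
    rw [add_mul, mul_add, mul_add]
    rcases h with h | h
    · have hpos : 0 < zs₁.length := List.length_pos_iff.2 h
      by_cases h0 : R₂.quants = 0 ∧ zs₂.length = 0
      · right
        have := Nat.mul_pos (openWeight_pos h0.1) hpos
        obtain rfl := List.length_eq_zero_iff.1 h0.2
        simp only [h0.1, exs, List.foldr_nil, mul_add, List.length_nil, mul_zero, add_zero,
          true_and]
        omega
      · left
        have : 0 < zs₁.length * (R₂.quants + zs₂.length) := Nat.mul_pos hpos (by omega)
        rw [mul_add] at this
        omega
    · have hpos : 0 < zs₂.length := List.length_pos_iff.2 h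
      by_cases h0 : R₁.quants = 0 ∧ zs₁.length = 0
      · right
        have := Nat.mul_pos (openWeight_pos h0.1) hpos
        obtain rfl := List.length_eq_zero_iff.1 h0.2
        simp only [h0.1, exs, List.foldr_nil, mul_add, List.length_nil, mul_zero, zero_mul,
          add_zero, true_and]
        omega
      · left
        have : 0 < (R₁.quants + zs₁.length) * zs₂.length := Nat.mul_pos (by omega) hpos
        rw [add_mul] at this
        omega

/-! ### Simplification of leaves -/

/-- The query becomes lighter, and no block gets more unsolved variables. -/
structure Shrinks (P P' : Query L) : Prop where
  quants : P'.quants = P.quants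
  parallel : P'.parallel = P.parallel
  openWeight : P'.openWeight ≤ P.openWeight
  crossing : P'.crossing ≤ P.crossing
  weight : weight P'.leaves < weight P.leaves
  unsolved : ∀ M, unsolvedCount (P'.leaves + M) ≤ unsolvedCount (P.leaves + M)
  blockSum : ∀ ws ws', Query.blockSum (fun _ => unsolvedCount) ws' P' ≤
    Query.blockSum (fun _ => unsolvedCount) ws P

namespace Shrinks

theorem andLeft (R : Query L) {P P' : Query L} (h : Shrinks P P') :
    Shrinks (Query.and P R) (Query.and P' R) := by
  have h₁ := Nat.mul_le_mul_right R.quants h.openWeight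
  have h₂ := h.openWeight
  have h₃ := h.crossing
  have h₄ := h.weight
  refine ⟨?_, ?_, ?_, ?_, ?_, fun M => ?_, fun _ _ => ?_⟩
  · simp [Query.quants, h.quants]
  · simp [Query.parallel, h.quants, h.parallel]
  · simp only [Query.openWeight]; omega
  · simp only [Query.crossing, h.quants]; omega
  · simp only [Query.leaves, weight_add]; omega
  · simpa only [Query.leaves, add_assoc] using h.unsolved (R.leaves + M)
  · exact Nat.add_le_add_right (h.blockSum _ _) _

theorem andRight (R : Query L) {P P' : Query L} (h : Shrinks P P') :
    Shrinks (Query.and R P) (Query.and R P') := by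
  have h₁ := Nat.mul_le_mul_right R.quants h.openWeight
  have h₂ := h.openWeight
  have h₃ := h.crossing
  have h₄ := h.weight
  refine ⟨?_, ?_, ?_, ?_, ?_, fun M => ?_, fun _ _ => ?_⟩
  · simp [Query.quants, h.quants]
  · simp [Query.parallel, h.quants, h.parallel]
  · simp only [Query.openWeight]; omega
  · simp only [Query.crossing, h.quants]; omega
  · simp only [Query.leaves, weight_add]; omega
  · simpa only [Query.leaves, add_assoc, add_left_comm] using h.unsolved (R.leaves + M)
  · exact Nat.add_le_add_left (h.blockSum _ _) _

/-- The arbitrary context in `unsolved` lets it pass through conjunctions; at an innermost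
quantifier the block is complete and the empty context suffices. -/
theorem ex (x : ℕ) {P P' : Query L} (h : Shrinks P P') :
    Shrinks (Query.ex x P) (Query.ex x P') := by
  refine ⟨by simp [Query.quants, h.quants], h.parallel, le_rfl, h.crossing, h.weight, h.unsolved,
    fun ws ws' => ?_⟩
  rw [Query.blockSum, Query.blockSum, h.quants]
  split_ifs
  · simpa using h.unsolved 0
  · exact h.blockSum _ _

/-- An equation is replaced by a lighter quantifier-free query. -/
theorem of_eq {s t : L.Term ℕ} {P' : Query L} (he : ∀ x, ¬ IsSide (Query.eq s t) x)
    (hq : P'.quants = 0) (hw : ConjQuery.weight P'.leaves < leafWeight (Query.eq s t))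
    (hv : vars P'.leaves ⊆ (Query.eq s t).freeVars) : Shrinks (Query.eq s t) P' := by
  have hw' : ConjQuery.weight P'.leaves < ConjQuery.weight (Query.eq s t).leaves := by
    simpa [Query.leaves, ConjQuery.weight] using hw
  refine ⟨hq, parallel_eq_zero hq, ?_, (crossing_eq_zero hq).le, hw', fun M => ?_, fun _ _ => ?_⟩
  · rw [openWeight_eq_weight hq]
    exact hw.le
  · exact unsolvedCount_replace_le he hv M
  · rw [blockSum_eq_zero _ _ hq]
    exact Nat.zero_le _

theorem tt_and (Q : Query L) : Shrinks (Query.and Query.tt Q) Q := by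
  have hw : ConjQuery.weight (Query.tt : Query L).leaves = 1 := by
    simp [Query.leaves, ConjQuery.weight, leafWeight]
  refine ⟨by simp [Query.quants], by simp [Query.parallel, Query.quants],
    Nat.le_add_left _ _, ?_, ?_, fun M => ?_, fun _ _ => ?_⟩
  · simp only [Query.crossing]; omega
  · simp only [Query.leaves, weight_add] at hw ⊢; omega
  · have := unsolvedCount_replace_le (e := (Query.tt : Query L)) (A' := 0)
      (by rintro x ⟨t, -, h | h⟩ <;> simp at h) (by simp [vars]) (Q.leaves + M)
    simpa [Query.leaves, add_assoc, ← Multiset.singleton_add] using this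
  · simp only [Query.blockSum, zero_add]
    exact (blockSum_const _ _ _ _).le

theorem and_tt (Q : Query L) : Shrinks (Query.and Q Query.tt) Q := by
  have hw : ConjQuery.weight (Query.tt : Query L).leaves = 1 := by
    simp [Query.leaves, ConjQuery.weight, leafWeight]
  refine ⟨by simp [Query.quants], by simp [Query.parallel, Query.quants],
    Nat.le_add_right _ _, ?_, ?_, fun M => ?_, fun _ _ => ?_⟩
  · simp only [Query.crossing]; omega
  · simp only [Query.leaves, weight_add] at hw ⊢; omega
  · have := unsolvedCount_replace_le (e := (Query.tt : Query L)) (A' := 0)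
      (by rintro x ⟨t, -, h | h⟩ <;> simp at h) (by simp [vars]) (Q.leaves + M)
    simpa [Query.leaves, add_left_comm, add_assoc, ← Multiset.singleton_add] using this
  · simp only [Query.blockSum, add_zero]
    exact (blockSum_const _ _ _ _).le

end Shrinks

theorem not_isSide_func_func {n m : ℕ} (f : L.Functions n) (g : L.Functions m)
    (s : Fin n → L.Term ℕ) (t : Fin m → L.Term ℕ) (x : ℕ) :
    ¬ IsSide (Query.eq (Term.func f s) (Term.func g t)) x := by
  rintro ⟨r, -, h | h⟩ <;> simp at h

theorem shrinks_decompose {n : ℕ} (f : L.Functions n) (s t : Fin n → L.Term ℕ) :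
    Shrinks (Query.eq (Term.func f s) (Term.func f t))
      (conj (List.ofFn fun i => Query.eq (s i) (t i))) := by
  have hall : ∀ A ∈ List.ofFn fun i => Query.eq (s i) (t i), A.IsEquation ∨ A.IsAtom := by
    intro A hA
    obtain ⟨i, rfl⟩ := (List.mem_ofFn' _ _).1 hA
    exact Or.inl ⟨_, _, rfl⟩
  have hq : (conj (List.ofFn fun i => Query.eq (s i) (t i))).quants = 0 :=
    quants_conj fun A hA => quants_of_isEquation_or_isAtom (hall A hA)
  -- For arity 0 the empty conjunction is `tt`, whose single leaf has weight 1 rather than 0.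
  cases n with
  | zero =>
    refine Shrinks.of_eq (not_isSide_func_func f f s t) hq ?_ ?_
    · simp [conj, leaves, weight, leafWeight, termSize]
    · simp [conj, leaves, vars, freeVars]
  | succ n =>
    have hl : (conj (List.ofFn fun i => Query.eq (s i) (t i))).leaves =
        ((List.ofFn fun i => Query.eq (s i) (t i) : List (Query L)) : Multiset (Query L)) := by
      rw [leaves_conj (by simp), sum_map_leaves hall]
    refine Shrinks.of_eq (not_isSide_func_func f f s t) hq ?_ ?_
    · rw [hl, weight, Multiset.map_coe, Multiset.sum_coe, List.map_ofFn, List.sum_ofFn]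
      simp only [Function.comp_apply, leafWeight, termSize, Finset.sum_add_distrib,
        ← Finset.mul_sum]
      omega
    · intro v hv
      rw [hl, mem_vars] at hv
      obtain ⟨q, hq, hv⟩ := hv
      obtain ⟨i, rfl⟩ := (List.mem_ofFn' _ _).1 (Multiset.mem_coe.1 hq)
      simp only [freeVars, Finset.mem_union, mem_varFinset_func] at hv ⊢
      exact hv.imp (fun h => ⟨i, h⟩) (fun h => ⟨i, h⟩)

theorem Shrinks.of_eq_const {s t : L.Term ℕ} {c : Query L} (hc : c = Query.tt ∨ c = Query.ff)
    (he : ∀ x, ¬ IsSide (Query.eq s t) x) : Shrinks (Query.eq s t) c := by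
  have := termSize_pos s
  have := termSize_pos t
  refine Shrinks.of_eq he ?_ ?_ ?_ <;> rcases hc with rfl | rfl <;>
    simp [Query.leaves, Query.quants, ConjQuery.weight, leafWeight, vars, freeVars] <;> omega

theorem not_isSide_of_mem {x : ℕ} {t : L.Term ℕ} (h : x ∈ t.varFinset) (y : ℕ) :
    ¬ IsSide (Query.eq (Term.var x) t) y := by
  rintro ⟨r, hr, e | e⟩
  · obtain ⟨rfl, rfl⟩ : x = y ∧ t = r := by simpa using e
    exact hr h
  · obtain ⟨rfl, rfl⟩ : Term.var x = r ∧ t = Term.var y := by simpa using e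
    simp only [Term.varFinset, Finset.mem_singleton] at hr h
    exact hr h.symm

theorem sameProfile_swap_atom {A : Query L} (hA : A.IsAtom) (s t : L.Term ℕ) :
    SameProfile (Query.and A (Query.eq s t)) (Query.and (Query.eq s t) A) ∧
      (Query.and (Query.eq s t) A).inversions < (Query.and A (Query.eq s t)).inversions := by
  classical
  obtain ⟨n, p, ts, rfl⟩ := hA
  constructor
  · constructor <;> simp [quants, parallel, openWeight, crossing, card, leaves, blockSum,
      add_comm]
  · have h : (Query.eq s t).IsEquation := ⟨s, t, rfl⟩
    simpa [inversions, card, leaves] using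
      Multiset.countP_pos.2 ⟨Query.eq s t, Multiset.mem_singleton_self _, h⟩

/-- The alternatives are `r8`; `r9`; the simplifications `r1` to `r4`, `r11_left` and `r11_right`;
and `r10`. Each is stable under contexts. -/
theorem Everywhere.localRule_cases {Q Q' : Query L} (h : Everywhere LocalRule Q Q') :
    Q'.quants < Q.quants ∨ Prenexes Q Q' ∨ Shrinks Q Q' ∨
      (SameProfile Q Q' ∧ Q'.inversions < Q.inversions) := by
  induction h with
  | here h =>
    cases h with
    | r1 f s t => exact Or.inr (Or.inr (Or.inl (shrinks_decompose f s t)))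
    | r2 f g s t _ =>
      exact Or.inr (Or.inr (Or.inl
        (Shrinks.of_eq_const (Or.inr rfl) (not_isSide_func_func f g s t))))
    | r3 x t _ hx =>
      exact Or.inr (Or.inr (Or.inl (Shrinks.of_eq_const (Or.inr rfl) (not_isSide_of_mem hx))))
    | r4 x =>
      exact Or.inr (Or.inr (Or.inl (Shrinks.of_eq_const (Or.inl rfl)
        (not_isSide_of_mem (by simp [Term.varFinset])))))
    | r8 ys zs y Q _ =>
      left
      simp only [quants_exs, List.length_append, List.length_cons]
      omega
    | r9 ys₁ ys₂ zs₁ zs₂ Q₁ Q₂ R₁ R₂ hne h₁ h₂ v₁ v₂ _ _ =>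
      right; left
      have hne' : zs₁ ≠ [] ∨ zs₂ ≠ [] := by
        simpa only [ne_eq, ← List.length_eq_zero_iff, h₁, h₂] using hne
      have hp := prenexes_exs R₁ R₂ hne'
      have s₁ := sameShape_of_variant v₁
      have s₂ := sameShape_of_variant v₂
      exact ⟨hp.1.trans (by simp [quants, s₁.1, s₂.1]),
        hp.2.trans (by simp [openWeight, s₁.3, s₂.3]),
        by simpa [parallel, crossing, s₁.1, s₂.1, s₁.2, s₂.2, s₁.3, s₂.3, s₁.4, s₂.4] using hp.3⟩
    | r10 A s t hA => exact Or.inr (Or.inr (Or.inr (sameProfile_swap_atom hA s t)))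
    | r11_left => exact Or.inr (Or.inr (Or.inl (Shrinks.tt_and _)))
    | r11_right => exact Or.inr (Or.inr (Or.inl (Shrinks.and_tt _)))
  | andLeft R _ ih =>
    refine ih.imp (fun h => by simp only [quants]; omega) (Or.imp (fun h => h.andLeft R)
      (Or.imp (fun h => h.andLeft R) fun h => ⟨h.1.and (SameProfile.refl R), ?_⟩))
    have := h.2
    simp only [inversions, h.1.card]
    omega
  | andRight R _ ih =>
    refine ih.imp (fun h => by simp only [quants]; omega) (Or.imp (fun h => h.andRight R)
      (Or.imp (fun h => h.andRight R) fun h => ⟨(SameProfile.refl R).and h.1, ?_⟩))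
    have := h.2
    simp only [inversions, h.1.leaves]
    omega
  | ex x _ ih =>
    exact ih.imp (fun h => by simp only [quants]; omega) (Or.imp (fun h => h.ex x)
      (Or.imp (fun h => h.ex x) fun h => ⟨h.1.ex x, h.2⟩))

/-! ### Blocks -/

/-- A lexicographic decrease of the first four numbers to the last four. -/
def LexDecrease (a b c d a' b' c' d' : ℕ) : Prop :=
  a' < a ∨ (a' ≤ a ∧ (b' < b ∨ (b' ≤ b ∧ (c' < c ∨ (c' ≤ c ∧ d' < d)))))

/-- `r5` lowers the first number, or else keeps the weight and lowers the state weight. `r6` lowers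
the first, or else the weight, as an equation outweighs `tt`. `r7` lowers the weight if the left
side is not a variable, otherwise `misoriented`. The list `rest` holds the quantifiers further out.
-/
theorem BlockRule.lexDecrease {ys : List ℕ} {B B' : Query L} (h : BlockRule ys B B')
    (rest : List ℕ) : B.quants = 0 ∧ B'.quants = 0 ∧
      LexDecrease (unsolvedCount B.leaves) (weight B.leaves)
        (stateWeight (ys.reverse ++ rest) B.leaves) (misoriented (ys.reverse ++ rest) B.leaves)
        (unsolvedCount B'.leaves) (weight B'.leaves)
        (stateWeight (ys.reverse ++ rest) B'.leaves)
        (misoriented (ys.reverse ++ rest) B'.leaves) := by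
  have hmap : ∀ {Q₁ Q₂ : List (Query L)} (x : ℕ) (t : L.Term ℕ),
      (∀ A ∈ Q₁ ++ Q₂, A.IsEquation ∨ A.IsAtom) →
      ∀ A ∈ Q₁.map (subst x t) ++ Q₂.map (subst x t), A.IsEquation ∨ A.IsAtom := by
    intro Q₁ Q₂ x t h A hA
    rw [← List.map_append] at hA
    obtain ⟨B, hB, rfl⟩ := List.mem_map.1 hA
    exact eq_or_isAtom_of_subst (h B hB) x t
  cases h with
  | r5 Q₁ Q₂ x t hA hxt _ hx =>
    refine ⟨quants_conj_insert hA rfl, quants_conj_insert (hmap x t hA) rfl, ?_⟩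
    rw [leaves_conj_insert hA rfl, leaves_conj_insert (hmap x t hA) rfl, ← List.map_append,
      ← Multiset.map_coe]
    have hM : ∀ A ∈ ((Q₁ ++ Q₂ : List (Query L)) : Multiset (Query L)),
        A.IsEquation ∨ A.IsAtom := fun A h => hA A (Multiset.mem_coe.1 h)
    have hx' : x ∈ vars ((Q₁ ++ Q₂ : List (Query L)) : Multiset (Query L)) := by
      obtain ⟨A, hA, hx⟩ := hx
      exact mem_vars.2 ⟨A, Multiset.mem_coe.2 hA, hx⟩
    rcases unsolvedCount_subst hM hxt hx' with h | ⟨h, z, hzx, rfl, hz⟩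
    · exact Or.inl h
    · refine Or.inr ⟨h, Or.inr ⟨?_, Or.inl (stateWeight_subst_var _ hM hzx hx' hz)⟩⟩
      rw [weight_cons, weight_cons, weight_map_subst hM (Or.inr ⟨z, rfl⟩)]
  | r6 Q₁ Q₂ x t hA hxt _ =>
    refine ⟨quants_conj_insert hA rfl, quants_conj_insert (hmap x t hA) rfl, ?_⟩
    rw [leaves_conj_insert hA rfl, leaves_conj_insert (hmap x t hA) rfl, ← List.map_append,
      ← Multiset.map_coe]
    have hM : ∀ A ∈ ((Q₁ ++ Q₂ : List (Query L)) : Multiset (Query L)),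
        A.IsEquation ∨ A.IsAtom := fun A h => hA A (Multiset.mem_coe.1 h)
    rcases unsolvedCount_eliminate hM hxt with h | ⟨h, h'⟩
    · exact Or.inl h
    · refine Or.inr ⟨h, Or.inl ?_⟩
      have := termSize_pos t
      rw [weight_cons, weight_cons, weight_map_subst hM h']
      simp only [leafWeight, termSize]
      omega
  | r7 Q₁ Q₂ x t hA hx =>
    refine ⟨quants_conj_insert hA rfl, quants_conj_insert hA rfl, ?_⟩
    rw [leaves_conj_insert hA rfl, leaves_conj_insert hA rfl]
    refine Or.inr ⟨(unsolvedCount_swap _ _ _).le, ?_⟩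
    rw [weight_cons, weight_cons]
    cases t with
    | func f ts =>
      left
      simp only [leafWeight, termSize]
      omega
    | var z =>
      rcases hx with hx | ⟨z', h, -, hz, hx⟩
      · exact absurd rfl (hx z)
      · obtain rfl := Term.var.inj h
        have hd := depth_lt_depth (rest := rest) hx hz
        exact Or.inr ⟨le_rfl, Or.inr ⟨stateWeight_swap hd, misoriented_swap hd⟩⟩

/-- A step (5)-(7) under a quantifier decreases the measures of the blocks and keeps the measures
of the quantifier structure. -/
structure BlockDecreases (P P' : Query L) : Prop where
  quants_ne_zero : P.quants ≠ 0
  quants : P'.quants = P.quants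
  parallel : P'.parallel = P.parallel
  openWeight : P'.openWeight = P.openWeight
  crossing : P'.crossing = P.crossing
  blockSum : ∀ ws, LexDecrease
    (Query.blockSum (fun _ => unsolvedCount) ws P) (weight P.leaves)
    (Query.blockSum stateWeight ws P) (Query.blockSum misoriented ws P)
    (Query.blockSum (fun _ => unsolvedCount) ws P') (weight P'.leaves)
    (Query.blockSum stateWeight ws P') (Query.blockSum misoriented ws P')

/-- Leaves may grow here, but under a nonempty prefix they carry no open weight, so `crossing`,
which precedes the block measures in `rank`, is unaffected. -/
theorem BlockStep.blockDecreases {ws : List ℕ} (hws : ws ≠ []) {P P' : Query L}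
    (h : BlockStep ws P P') : BlockDecreases P P' := by
  obtain ⟨xs, ys, B, B', h⟩ := h
  obtain ⟨hB, hB', -⟩ := h.lexDecrease []
  refine ⟨?_, ?_, ?_, ?_, ?_, fun rest => ?_⟩
  · intro h
    rw [quants_exs, Nat.add_eq_zero_iff] at h
    exact hws (List.length_eq_zero_iff.1 h.2)
  · rw [quants_exs, quants_exs, hB, hB']
  · rw [parallel_exs, parallel_exs, parallel_eq_zero hB, parallel_eq_zero hB']
  · rw [openWeight_exs hws, openWeight_exs hws]
  · rw [crossing_exs, crossing_exs, crossing_eq_zero hB, crossing_eq_zero hB']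
  · simp only [blockSum_exs _ hws _ hB, blockSum_exs _ hws _ hB', leaves_exs,
      List.reverse_append, List.append_assoc]
    exact (h.lexDecrease _).2.2

theorem Everywhere.blockDecreases {Q Q' : Query L}
    (h : Everywhere (fun P P' => ∃ ws, ws ≠ [] ∧ BlockStep ws P P') Q Q') :
    BlockDecreases Q Q' := by
  induction h with
  | here h =>
    obtain ⟨ws, hws, h⟩ := h
    exact h.blockDecreases hws
  | andLeft R _ ih =>
    refine ⟨?_, ?_, ?_, ?_, ?_, fun ws => ?_⟩
    · have := ih.1
      simp only [quants]
      omega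
    · simp [quants, ih.quants]
    · simp [parallel, ih.quants, ih.parallel]
    · simp [openWeight, ih.openWeight]
    · simp [crossing, ih.quants, ih.openWeight, ih.crossing]
    · have := ih.blockSum []
      simp only [LexDecrease, blockSum, leaves, weight_add] at this ⊢
      omega
  | andRight R _ ih =>
    refine ⟨?_, ?_, ?_, ?_, ?_, fun ws => ?_⟩
    · have := ih.1
      simp only [quants]
      omega
    · simp [quants, ih.quants]
    · simp [parallel, ih.quants, ih.parallel]
    · simp [openWeight, ih.openWeight]
    · simp [crossing, ih.quants, ih.openWeight, ih.crossing]
    · have := ih.blockSum []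
      simp only [LexDecrease, blockSum, leaves, weight_add] at this ⊢
      omega
  | ex x _ ih =>
    refine ⟨Nat.succ_ne_zero _, by simp [quants, ih.quants], ih.parallel, rfl, ih.crossing,
      fun ws => ?_⟩
    -- The rewritten part already contains a quantifier, so `x` only lengthens the prefix.
    simpa only [blockSum, ih.quants, if_neg ih.1, leaves] using ih.blockSum (x :: ws)

/-! ### Termination -/

/-- The termination measure. The whole query is put under a dummy quantifier, so that it counts as
a block if it is quantifier-free. -/
noncomputable def rank (Q : Query L) : ℕ ×ₗ ℕ ×ₗ ℕ ×ₗ ℕ ×ₗ ℕ ×ₗ ℕ ×ₗ ℕ ×ₗ ℕ :=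
  toLex (Q.quants, toLex (Q.parallel, toLex (Q.crossing,
    toLex (blockSum (fun _ => unsolvedCount) [] (Query.ex 0 Q), toLex (weight Q.leaves,
      toLex (blockSum stateWeight [] (Query.ex 0 Q),
        toLex (blockSum misoriented [] (Query.ex 0 Q), Q.inversions)))))))

theorem rank_lt_rank {Q Q' : Query L} (h : Q'.quants < Q.quants ∨ (Q'.quants = Q.quants ∧
    (Q'.parallel < Q.parallel ∨ (Q'.parallel = Q.parallel ∧
    (Q'.crossing < Q.crossing ∨ (Q'.crossing ≤ Q.crossing ∧
    (LexDecrease (blockSum (fun _ => unsolvedCount) [] (Query.ex 0 Q)) (weight Q.leaves)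
      (blockSum stateWeight [] (Query.ex 0 Q)) (blockSum misoriented [] (Query.ex 0 Q))
      (blockSum (fun _ => unsolvedCount) [] (Query.ex 0 Q')) (weight Q'.leaves)
      (blockSum stateWeight [] (Query.ex 0 Q')) (blockSum misoriented [] (Query.ex 0 Q')) ∨
    (SameProfile Q Q' ∧ Q'.inversions < Q.inversions)))))))) : rank Q' < rank Q := by
  simp only [rank, Prod.Lex.toLex_lt_toLex]
  have key : SameProfile Q Q' → ∀ F, blockSum F [] (Query.ex 0 Q') =
      blockSum F [] (Query.ex 0 Q) := fun h F => (h.ex 0).blockSum F []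
  rcases h with h | ⟨h₁, h | ⟨h₂, h | ⟨h₃, h | ⟨h, h'⟩⟩⟩⟩
  · omega
  · omega
  · omega
  · simp only [LexDecrease] at h
    omega
  · rw [key h, key h, key h, h.quants, h.parallel, h.crossing, h.leaves]
    omega

theorem rank_eq_of_assocEq {Q Q' : Query L} (h : AssocEq Q Q') : rank Q' = rank Q := by
  obtain ⟨h, h'⟩ := sameProfile_of_assocEq h
  simp only [rank, h.quants, h.parallel, h.crossing, h.leaves, h', (h.ex 0).blockSum]

theorem rank_lt_of_block {Q Q' : Query L}
    (h : Everywhere (fun P P' => ∃ ws, ws ≠ [] ∧ BlockStep ws P P')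
      (Query.ex 0 Q) (Query.ex 0 Q')) : rank Q' < rank Q := by
  have h := h.blockDecreases
  exact rank_lt_rank (Or.inr ⟨by simpa [quants] using h.quants, Or.inr ⟨h.parallel,
    Or.inr ⟨h.crossing.le, Or.inl (h.blockSum [])⟩⟩⟩)

theorem rank_lt_of_elementary {Q Q' : Query L} (h : Elementary Q Q') :
    (Q.HasFF ∧ Q' = Query.ff) ∨ rank Q' < rank Q := by
  cases h with
  | anywhere h =>
    right
    rcases h.localRule_cases with h | h | h | h
    · exact rank_lt_rank (Or.inl h)
    · refine rank_lt_rank (Or.inr ⟨h.quants, ?_⟩)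
      exact h.parallel.imp id fun h => ⟨h.1, Or.inl h.2⟩
    · exact rank_lt_rank (Or.inr ⟨h.quants, Or.inr ⟨h.parallel, Or.inr ⟨h.crossing,
        Or.inl (Or.inr ⟨(h.ex 0).blockSum _ _, Or.inl h.weight⟩)⟩⟩⟩)
    · exact rank_lt_rank (Or.inr ⟨h.1.quants, Or.inr ⟨h.1.parallel, Or.inr ⟨h.1.crossing.le,
        Or.inr h⟩⟩⟩)
  | wholeBlock ws h =>
    right
    obtain ⟨xs, ys, B, B', h⟩ := h
    -- The dummy quantifier of `rank` makes the prefix nonempty; it joins `xs`, so the segment `ys`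
    -- governing the rule is unchanged.
    exact rank_lt_of_block (Everywhere.here ⟨0 :: (xs ++ ys), by simp,
      BlockStep.intro (0 :: xs) ys B B' h⟩)
  | innerBlock h => exact Or.inr (rank_lt_of_block (Everywhere.ex 0 h))
  | r12 h => exact Or.inl ⟨h, rfl⟩

theorem rank_lt_of_step {Q Q' : Query L} (h : Step Q Q') :
    Q' = Query.ff ∨ rank Q' < rank Q := by
  obtain ⟨-, P, P', hP, h, hP'⟩ := h
  rcases rank_lt_of_elementary h with ⟨-, rfl⟩ | h
  · exact Or.inl (eq_of_assocEq_ff hP')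
  · right
    rwa [rank_eq_of_assocEq hP', ← rank_eq_of_assocEq hP]

/-- Step `r12` needs no decrease of `rank`: its result `ff` has no successor and is accessible
outright. -/
theorem wellFounded_step : WellFounded fun Q' Q : Query L => Step Q Q' := by
  have hacc : ∀ Q : Query L, Q = Query.ff → Acc (fun Q' Q : Query L => Step Q Q') Q :=
    fun Q hQ => ⟨Q, fun _ h => absurd hQ h.1⟩
  refine ⟨fun Q => ?_⟩
  induction Q using (InvImage.wf (rank (L := L)) wellFounded_lt).induction with
  | _ Q ih =>
    refine ⟨Q, fun Q' h => ?_⟩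
    rcases rank_lt_of_step h with h | h
    · exact hacc Q' h
    · exact ih Q' h

theorem exists_output (Q : Query L) : ∃ Q', Output Q Q' := by
  induction Q using (wellFounded_step (L := L)).induction with
  | _ Q ih =>
    by_cases h : ∃ R, Step Q R
    · obtain ⟨R, hR⟩ := h
      obtain ⟨Q', hQ', h⟩ := ih R hR
      exact ⟨Q', Relation.ReflTransGen.head hR hQ', h⟩
    · exact ⟨Q, Relation.ReflTransGen.refl, Or.inr h⟩

/-! ### Bracketing -/

namespace AssocEq

theorem refl (P : Query L) : AssocEq P P := Relation.EqvGen.refl P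

theorem symm {P Q : Query L} (h : AssocEq P Q) : AssocEq Q P := Relation.EqvGen.symm _ _ h

theorem trans {P Q R : Query L} (h : AssocEq P Q) (h' : AssocEq Q R) : AssocEq P R :=
  Relation.EqvGen.trans _ _ _ h h'

theorem assoc (P Q R : Query L) :
    AssocEq (Query.and (Query.and P Q) R) (Query.and P (Query.and Q R)) :=
  Relation.EqvGen.rel _ _ (Everywhere.here (AssocRule.assoc P Q R))

theorem map {f : Query L → Query L}
    (hf : ∀ P Q, Everywhere AssocRule P Q → Everywhere AssocRule (f P) (f Q))
    {P Q : Query L} (h : AssocEq P Q) : AssocEq (f P) (f Q) := by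
  induction h with
  | rel _ _ h => exact Relation.EqvGen.rel _ _ (hf _ _ h)
  | refl => exact refl _
  | symm _ _ _ ih => exact ih.symm
  | trans _ _ _ _ _ ih ih' => exact ih.trans ih'

theorem and {P P' R R' : Query L} (h : AssocEq P P') (h' : AssocEq R R') :
    AssocEq (Query.and P R) (Query.and P' R') :=
  (h.map (f := fun X => Query.and X R) fun _ _ => Everywhere.andLeft R).trans
    (h'.map (f := fun X => Query.and P' X) fun _ _ => Everywhere.andRight P')

theorem exs (ys : List ℕ) {P P' : Query L} (h : AssocEq P P') :
    AssocEq (Query.exs ys P) (Query.exs ys P') := by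
  induction ys with
  | nil => exact h
  | cons y ys ih => exact ih.map (f := Query.ex y) fun _ _ => Everywhere.ex y

theorem conj_append {l l' : List (Query L)} (h : l ≠ []) (h' : l' ≠ []) :
    AssocEq (Query.and (Query.conj l) (Query.conj l')) (Query.conj (l ++ l')) := by
  induction l with
  | nil => exact absurd rfl h
  | cons A l ih =>
    cases l with
    | nil =>
      rw [List.singleton_append, Query.conj_cons h']
      exact refl _
    | cons B l =>
      rw [List.cons_append, Query.conj_cons (l := B :: l ++ l') (by simp),
        Query.conj_cons (l := B :: l) (by simp)]
      exact (assoc _ _ _).trans ((refl A).and (ih (by simp)))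

end AssocEq

theorem exists_conj {B : Query L} (h : B.quants = 0) : ∃ l : List (Query L), l ≠ [] ∧
    AssocEq B (Query.conj l) ∧
    ∀ A ∈ l, A.IsEquation ∨ A.IsAtom ∨ A = Query.tt ∨ (A = Query.ff ∧ B.HasFF) := by
  induction B with
  | tt => exact ⟨[Query.tt], by simp, AssocEq.refl _, by simp⟩
  | ff => exact ⟨[Query.ff], by simp, AssocEq.refl _, by simp [Query.HasFF]⟩
  | eq s t => exact ⟨[Query.eq s t], by simp, AssocEq.refl _, by simp [Query.IsEquation]⟩
  | atom p ts =>
    exact ⟨[Query.atom p ts], by simp, AssocEq.refl _, fun A hA => by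
      rw [List.mem_singleton] at hA
      exact Or.inr (Or.inl ⟨_, p, ts, hA⟩)⟩
  | and P R ihP ihR =>
    simp only [Query.quants, Nat.add_eq_zero_iff] at h
    obtain ⟨l, hl, hP, hlA⟩ := ihP h.1
    obtain ⟨l', hl', hR, hlA'⟩ := ihR h.2
    refine ⟨l ++ l', by simp [hl], (hP.and hR).trans (AssocEq.conj_append hl hl'), fun A hA => ?_⟩
    rcases List.mem_append.1 hA with hA | hA
    · exact (hlA A hA).imp id (Or.imp id (Or.imp id fun h => ⟨h.1, Or.inl h.2⟩))
    · exact (hlA' A hA).imp id (Or.imp id (Or.imp id fun h => ⟨h.1, Or.inr h.2⟩))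
  | ex x P => simp [Query.quants] at h

/-! ### Applicability of the steps -/

/-- All variables occurring in a query, including the bound ones. -/
def Query.allVars : Query L → Finset ℕ
  | and P R => P.allVars ∪ R.allVars
  | ex x P => insert x P.allVars
  | q => q.freeVars

theorem Query.freeVars_subset_allVars (Q : Query L) : Q.freeVars ⊆ Q.allVars := by
  induction Q with
  | and P R ihP ihR => exact Finset.union_subset_union ihP ihR
  | ex x P ih =>
    exact (Finset.erase_subset _ _).trans (ih.trans (Finset.subset_insert _ _))
  | _ => exact Finset.Subset.refl _

theorem Query.substitutible_of_notMem_allVars {Q : Query L} {x z : ℕ} (h : z ∉ Q.allVars) :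
    Q.Substitutible x (Term.var z) := by
  induction Q with
  | and P R ihP ihR =>
    simp only [allVars, Finset.mem_union, not_or] at h
    exact ⟨ihP h.1, ihR h.2⟩
  | ex y P ih =>
    simp only [allVars, Finset.mem_insert, not_or] at h
    exact Or.inr ⟨by simpa [Term.varFinset] using Ne.symm h.1, ih h.2⟩
  | _ => trivial

/-- A variable outside all variables of `P`, bound ones included, cannot be captured; avoiding `S`
as well meets the side condition of `r9`. -/
theorem exists_variant_ex (x : ℕ) (P : Query L) (S : Finset ℕ) :
    ∃ z P', z ∉ S ∧ Variant (Query.ex x P) (Query.ex z P') := by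
  obtain ⟨z, hz⟩ := Infinite.exists_notMem_finset (P.allVars ∪ S)
  simp only [Finset.mem_union, not_or] at hz
  exact ⟨z, P.subst x (Term.var z), hz.2, Relation.ReflTransGen.single
    (Everywhere.here (RenameRule.rename x z P (fun h => hz.1 (P.freeVars_subset_allVars h))
      (Query.substitutible_of_notMem_allVars hz.1)))⟩

theorem exists_localRule_ex_and (x : ℕ) (P R : Query L) :
    ∃ X, LocalRule (Query.and (Query.ex x P) R) X := by
  obtain ⟨z, P', hz, h⟩ := exists_variant_ex x P R.freeVars
  exact ⟨_, LocalRule.r9 [x] [] [z] [] P R P' R (by simp) rfl rfl h Relation.ReflTransGen.refl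
    (by simp) (by simpa using hz)⟩

theorem exists_localRule_and_ex (x : ℕ) (P R : Query L) :
    ∃ X, LocalRule (Query.and R (Query.ex x P)) X := by
  obtain ⟨z, P', hz, h⟩ := exists_variant_ex x P R.freeVars
  exact ⟨_, LocalRule.r9 [] [x] [] [z] R P R P' (by simp) rfl rfl Relation.ReflTransGen.refl h
    (by simpa using hz) (by simp)⟩

/-- A query is prenex, or quantifiers can be moved out of a conjunction. -/
theorem exists_localRule_or_prenex (Q : Query L) : (∃ X, Everywhere LocalRule Q X) ∨
    ∃ ws B, B.quants = 0 ∧ Q = Query.exs ws B := by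
  induction Q with
  | and P R ihP ihR =>
    rcases ihP with ⟨X, h⟩ | ⟨ws, B, hB, rfl⟩
    · exact Or.inl ⟨_, h.andLeft R⟩
    rcases ihR with ⟨X, h⟩ | ⟨ws', B', hB', rfl⟩
    · exact Or.inl ⟨_, h.andRight _⟩
    rcases ws with _ | ⟨x, ws⟩
    · rcases ws' with _ | ⟨x, ws'⟩
      · exact Or.inr ⟨[], Query.and B B', by simp [Query.quants, hB, hB'], rfl⟩
      · obtain ⟨X, h⟩ := exists_localRule_and_ex x (Query.exs ws' B') (Query.exs [] B)
        exact Or.inl ⟨X, Everywhere.here h⟩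
    · obtain ⟨X, h⟩ := exists_localRule_ex_and x (Query.exs ws B) (Query.exs ws' B')
      exact Or.inl ⟨X, Everywhere.here h⟩
  | ex x P ih =>
    rcases ih with ⟨X, h⟩ | ⟨ws, B, hB, rfl⟩
    · exact Or.inl ⟨_, h.ex x⟩
    · exact Or.inr ⟨x :: ws, B, hB, rfl⟩
  | _ => exact Or.inr ⟨[], _, rfl, rfl⟩

theorem Everywhere.exs {r : Query L → Query L → Prop} (ys : List ℕ) {P P' : Query L}
    (h : Everywhere r P P') : Everywhere r (Query.exs ys P) (Query.exs ys P') := by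
  induction ys with
  | nil => exact h
  | cons y ys ih => exact ih.ex y

theorem exists_everywhere_conj_append {r : Query L → Query L → Prop} {l : List (Query L)}
    (hl : l ≠ []) (h : ∃ P X, AssocEq (Query.conj l) P ∧ Everywhere r P X)
    (l₁ : List (Query L)) :
    ∃ P X, AssocEq (Query.conj (l₁ ++ l)) P ∧ Everywhere r P X := by
  induction l₁ with
  | nil => exact h
  | cons A l₁ ih =>
    obtain ⟨P, X, hP, hX⟩ := ih
    rw [List.cons_append, Query.conj_cons (by simp [hl])]
    exact ⟨_, _, (AssocEq.refl A).and hP, hX.andRight A⟩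

theorem exists_everywhere_conj_of_mem {r : Query L → Query L → Prop} {l : List (Query L)}
    {A A' : Query L} (hA : A ∈ l) (h : r A A') :
    ∃ P X, AssocEq (Query.conj l) P ∧ Everywhere r P X := by
  obtain ⟨l₁, l₂, rfl⟩ := List.append_of_mem hA
  refine exists_everywhere_conj_append (by simp) ?_ l₁
  cases l₂ with
  | nil => exact ⟨_, _, AssocEq.refl _, Everywhere.here h⟩
  | cons B l₂ => exact ⟨_, _, AssocEq.refl _, (Everywhere.here h).andLeft _⟩

theorem exists_everywhere_conj_tt {l : List (Query L)} (hl : Query.tt ∈ l) (hl' : l ≠ [Query.tt]) :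
    ∃ P X, AssocEq (Query.conj l) P ∧ Everywhere LocalRule P X := by
  obtain ⟨l₁, l₂, rfl⟩ := List.append_of_mem hl
  rcases l₂ with _ | ⟨B, l₂⟩
  · rcases List.eq_nil_or_concat' l₁ with rfl | ⟨l₁, A, rfl⟩
    · exact absurd rfl hl'
    · rw [List.append_assoc]
      exact exists_everywhere_conj_append (by simp)
        ⟨_, _, AssocEq.refl _, Everywhere.here (LocalRule.r11_right A)⟩ l₁
  · exact exists_everywhere_conj_append (by simp)
      ⟨_, _, AssocEq.refl _, Everywhere.here (LocalRule.r11_left _)⟩ l₁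

theorem exists_everywhere_conj_swap {l₁ l₂ : List (Query L)} {A : Query L} {s t : L.Term ℕ}
    (hA : A.IsAtom) : ∃ P X, AssocEq (Query.conj (l₁ ++ A :: Query.eq s t :: l₂)) P ∧
      Everywhere LocalRule P X := by
  refine exists_everywhere_conj_append (by simp) ?_ l₁
  rcases l₂ with _ | ⟨B, l₂⟩
  · exact ⟨_, _, AssocEq.refl _, Everywhere.here (LocalRule.r10 A s t hA)⟩
  -- With right-nested brackets the pair to be exchanged is not a subquery, so it is bracketed
  -- together first.
  · exact ⟨_, _, (AssocEq.assoc A (Query.eq s t) (Query.conj (B :: l₂))).symm,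
      (Everywhere.here (LocalRule.r10 A s t hA)).andLeft _⟩

/-- An unsorted list has an adjacent inversion, which is exactly what `r10` can exchange. -/
theorem eqs_append_atoms_or (l : List (Query L)) (h : ∀ A ∈ l, A.IsEquation ∨ A.IsAtom) :
    (∃ l₁ A s t l₂, l = l₁ ++ A :: Query.eq s t :: l₂ ∧ A.IsAtom) ∨
      ∃ (eqs : List (L.Term ℕ × L.Term ℕ)) (atoms : List (Query L)),
        l = eqs.map (fun e => Query.eq e.1 e.2) ++ atoms ∧ ∀ A ∈ atoms, A.IsAtom := by
  induction l with
  | nil => exact Or.inr ⟨[], [], rfl, by simp⟩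
  | cons A l ih =>
    rcases ih fun B hB => h B (by simp [hB]) with
      ⟨l₁, B, s, t, l₂, rfl, hB⟩ | ⟨eqs, atoms, rfl, hat⟩
    · exact Or.inl ⟨A :: l₁, B, s, t, l₂, rfl, hB⟩
    · rcases h A (by simp) with ⟨s, t, rfl⟩ | hA
      · exact Or.inr ⟨(s, t) :: eqs, atoms, rfl, hat⟩
      · rcases eqs with _ | ⟨e, eqs⟩
        · exact Or.inr ⟨[], A :: atoms, rfl, by simpa using ⟨hA, hat⟩⟩
        · exact Or.inl ⟨[], A, e.1, e.2, eqs.map (fun e => Query.eq e.1 e.2) ++ atoms, rfl, hA⟩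

theorem exists_map_fst_var (eqs : List (L.Term ℕ × L.Term ℕ))
    (h : ∀ e ∈ eqs, ∃ x, e.1 = Term.var x) :
    ∃ eqs' : List (ℕ × L.Term ℕ), eqs = eqs'.map fun e => (Term.var e.1, e.2) := by
  induction eqs with
  | nil => exact ⟨[], rfl⟩
  | cons e eqs ih =>
    obtain ⟨eqs', rfl⟩ := ih fun e he => h e (by simp [he])
    obtain ⟨x, hx⟩ := h e (by simp)
    exact ⟨(x, e.2) :: eqs', by simp [← hx]⟩

theorem pairwise_of_forall_append {α : Type*} {R : α → α → Prop} {l : List α}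
    (h : ∀ l₁ a l₂, l = l₁ ++ a :: l₂ → ∀ b ∈ l₂, R a b) : l.Pairwise R := by
  induction l with
  | nil => exact List.Pairwise.nil
  | cons a l ih =>
    refine List.Pairwise.cons (h [] a l rfl) (ih fun l₁ b l₂ e => h (a :: l₁) b l₂ ?_)
    rw [e, List.cons_append]

/-- A terminal query different from `ff` is in solved form. -/
theorem inSolvedForm_of_terminal {Q : Query L} (hQ : Q ≠ Query.ff) (h : ¬ ∃ R, Step Q R) :
    InSolvedForm Q := by
  have step : ∀ {P X : Query L}, AssocEq Q P → ¬ Elementary P X := fun hP hX =>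
    h ⟨_, hQ, _, _, hP, hX, AssocEq.refl _⟩
  rcases exists_localRule_or_prenex Q with ⟨X, hX⟩ | ⟨ws, B, hB, rfl⟩
  · exact absurd (Elementary.anywhere hX) (step (AssocEq.refl _))
  have hff : ¬ (Query.exs ws B).HasFF := fun hff => step (AssocEq.refl _) (Elementary.r12 _ hff)
  have hff' : ¬ B.HasFF := by
    intro hB
    refine hff ?_
    clear * - hB
    induction ws with
    | nil => exact hB
    | cons y ys ih => exact ih
  obtain ⟨l, hl, hBl, hlA⟩ := exists_conj hB
  have hQl : AssocEq (Query.exs ws B) (Query.exs ws (Query.conj l)) := hBl.exs ws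
  have hloc : ¬ ∃ P X, AssocEq (Query.conj l) P ∧ Everywhere LocalRule P X :=
    fun ⟨P, X, hP, hX⟩ => step (hQl.trans (hP.exs ws)) (Elementary.anywhere (hX.exs ws))
  have hblock : ∀ {B'}, ¬ BlockRule ws (Query.conj l) B' := fun hb =>
    step hQl (Elementary.wholeBlock _ (BlockStep.intro [] ws _ _ hb))
  -- `r8` removes any vacuous quantifier. This gives both that bound variables occur in the body and
  -- that none is bound again further in.
  have hquant : ∀ a y b, ws = a ++ y :: b → y ∈ (Query.exs b (Query.conj l)).freeVars := by
    intro a y b hws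
    by_contra hy
    subst hws
    exact step hQl (Elementary.anywhere (Everywhere.here (LocalRule.r8 a b y _ hy)))
  have hzs : ∀ z ∈ ws, z ∈ (Query.conj l).freeVars := by
    intro z hz
    obtain ⟨a, b, hws⟩ := List.append_of_mem hz
    exact (Query.mem_freeVars_exs.1 (hquant a z b hws)).1
  have hws_nodup : ws.Nodup := pairwise_of_forall_append fun a y b hws y' hy' e =>
    (Query.mem_freeVars_exs.1 (hquant a y b hws)).2 (e ▸ hy')
  by_cases htt : Query.tt ∈ l
  · by_cases hl' : l = [Query.tt]
    · subst hl'
      cases ws with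
      | nil =>
        exact Or.inl (eq_of_assocEq_const (Or.inl rfl) hBl.symm)
      | cons y ys =>
        have := hzs y (by simp)
        simp [Query.conj, Query.freeVars] at this
    · exact absurd (exists_everywhere_conj_tt htt hl') hloc
  have hlA' : ∀ A ∈ l, A.IsEquation ∨ A.IsAtom := by
    intro A hA
    rcases hlA A hA with h | h | rfl | h
    · exact Or.inl h
    · exact Or.inr h
    · exact absurd hA htt
    · exact absurd h.2 hff'
  rcases eqs_append_atoms_or l hlA' with ⟨l₁, A, s, t, l₂, rfl, hA⟩ | ⟨eqs, atoms, rfl, hat⟩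
  · exact absurd (exists_everywhere_conj_swap hA) hloc
  have hvar : ∀ e ∈ eqs, ∃ x, e.1 = Term.var x := by
    rintro ⟨s, t⟩ he
    have hmem : Query.eq s t ∈ eqs.map (fun e => Query.eq e.1 e.2) ++ atoms :=
      List.mem_append_left _ (List.mem_map.2 ⟨_, he, rfl⟩)
    cases s with
    | var x => exact ⟨x, rfl⟩
    | @func n f ss =>
      exfalso
      cases t with
      | var x =>
        obtain ⟨l₁, l₂, e⟩ := List.append_of_mem hmem
        rw [e] at hblock hlA'
        exact hblock (BlockRule.r7 ws l₁ l₂ x _ (fun A hA => hlA' A (by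
          simp only [List.mem_append, List.mem_cons] at hA ⊢
          tauto)) (Or.inl (by simp)))
      | @func m g ts =>
        by_cases hfg : (⟨n, f⟩ : Σ k, L.Functions k) = ⟨m, g⟩
        · cases hfg
          exact hloc (exists_everywhere_conj_of_mem hmem (LocalRule.r1 f ss ts))
        · exact hloc (exists_everywhere_conj_of_mem hmem (LocalRule.r2 f g ss ts hfg))
  obtain ⟨eqs', heqs⟩ := exists_map_fst_var eqs hvar
  have hmap : eqs.map (fun e => Query.eq e.1 e.2) =
      eqs'.map fun e => Query.eq (Term.var e.1) e.2 := by
    rw [heqs, List.map_map]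
    rfl
  rw [hmap] at hQl hloc hblock hzs hlA'
  clear hvar heqs hmap hlA htt hBl hl hquant
  have hocc : ∀ e ∈ eqs', e.1 ∉ e.2.varFinset := by
    rintro ⟨x, t⟩ he hx
    have hmem : Query.eq (Term.var x) t ∈
        eqs'.map (fun e => Query.eq (Term.var e.1) e.2) ++ atoms :=
      List.mem_append_left _ (List.mem_map.2 ⟨_, he, rfl⟩)
    by_cases ht : t = Term.var x
    · subst ht
      exact hloc (exists_everywhere_conj_of_mem hmem (LocalRule.r4 x))
    · exact hloc (exists_everywhere_conj_of_mem hmem (LocalRule.r3 x t ht hx))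
  have hleaf : ∀ {l₁ l₂ : List (Query L)} {e : Query L},
      eqs'.map (fun e => Query.eq (Term.var e.1) e.2) ++ atoms = l₁ ++ e :: l₂ →
      ∀ A ∈ l₁ ++ l₂, A.IsEquation ∨ A.IsAtom := by
    intro l₁ l₂ e h A hA
    refine hlA' A ?_
    rw [h]
    simp only [List.mem_append, List.mem_cons] at hA ⊢
    tauto
  -- A quantified left-hand variable would allow `r6`; a free one occurring elsewhere would allow
  -- `r5`.
  have hisol : ∀ a e b, eqs' = a ++ e :: b → e.1 ∉ ws ∧
      (∀ e' ∈ a ++ b, e.1 ≠ e'.1 ∧ e.1 ∉ e'.2.varFinset) ∧ ∀ A ∈ atoms, e.1 ∉ A.freeVars := by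
    rintro a ⟨x, t⟩ b rfl
    have hxt := hocc (x, t) (by simp)
    have hsplit : (a ++ (x, t) :: b).map (fun e => Query.eq (Term.var e.1) e.2) ++ atoms =
        a.map (fun e => Query.eq (Term.var e.1) e.2) ++ Query.eq (Term.var x) t ::
          (b.map (fun e => Query.eq (Term.var e.1) e.2) ++ atoms) := by simp
    have hleaf' := hleaf hsplit
    rw [hsplit] at hblock
    have hx : x ∉ ws := fun hx => hblock (BlockRule.r6 ws _ _ x t hleaf' hxt hx)
    have hfree : ∀ A ∈ a.map (fun e => Query.eq (Term.var e.1) e.2) ++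
        (b.map (fun e => Query.eq (Term.var e.1) e.2) ++ atoms), x ∉ A.freeVars :=
      fun A hA hxA => hblock (BlockRule.r5 ws _ _ x t hleaf' hxt hx ⟨A, hA, hxA⟩)
    refine ⟨hx, fun e' he' => ?_, fun A hA => hfree A (by simp [hA])⟩
    have := hfree (Query.eq (Term.var e'.1) e'.2) (by
      rw [← List.append_assoc, ← List.map_append]
      exact List.mem_append_left _ (List.mem_map.2 ⟨e', he', rfl⟩))
    simpa [Query.freeVars, Term.varFinset] using this
  have hfst : ∀ x ∈ eqs'.map Prod.fst, x ∉ ws := by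
    intro x hx
    obtain ⟨e, he, rfl⟩ := List.mem_map.1 hx
    obtain ⟨a, b, h⟩ := List.append_of_mem he
    exact (hisol a e b h).1
  refine Or.inr (Or.inr ⟨ws, eqs', atoms, _, rfl, hQl, hat, ?_, ?_, hzs, ?_⟩)
  · refine List.nodup_append.2 ⟨?_, hws_nodup, fun x hx z hz hxz => hfst x hx (hxz ▸ hz)⟩
    rw [List.Nodup, List.pairwise_map]
    exact pairwise_of_forall_append fun a e b h e' he' => ((hisol a e b h).2.1 e' (by simp [he'])).1
  · intro x hx
    obtain ⟨e, he, rfl⟩ := List.mem_map.1 hx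
    obtain ⟨a, b, h⟩ := List.append_of_mem he
    refine ⟨fun e' he' => ?_, (hisol a e b h).2.2⟩
    rw [h, List.mem_append, List.mem_cons] at he'
    rcases he' with he' | rfl | he'
    · exact ((hisol a e b h).2.1 e' (by simp [he'])).2
    · exact hocc _ he
    · exact ((hisol a e b h).2.1 e' (by simp [he'])).2
  -- Here x = z with z quantified; x is not quantified, so the second form of `r7` would apply.
  · rintro z hz ⟨x, t⟩ he rfl
    have hx : x ∉ ws := hfst x (List.mem_map.2 ⟨_, he, rfl⟩)
    have hmem : Query.eq (Term.var x) (Term.var z) ∈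
        eqs'.map (fun e => Query.eq (Term.var e.1) e.2) ++ atoms :=
      List.mem_append_left _ (List.mem_map.2 ⟨_, he, rfl⟩)
    obtain ⟨l₁, l₂, e⟩ := List.append_of_mem hmem
    have hleaf' := hleaf e
    rw [e] at hblock
    exact hblock (BlockRule.r7 ws l₁ l₂ z _ hleaf'
      (Or.inr ⟨x, rfl, fun h => hx (h ▸ hz), hx, hz⟩))

end ConjQuery

/-! ### The main theorem -/

theorem mainTheorem1 (L : FirstOrder.Language.{u, v}) (Q : ConjQuery.Query L) :
    (¬ ∃ run : ℕ → ConjQuery.Query L,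
        run 0 = Q ∧ ∀ n, ConjQuery.Step (run n) (run (n + 1))) ∧
    (∃ Q', ConjQuery.Output Q Q') ∧
    (∀ Q', ConjQuery.Output Q Q' →
      ConjQuery.InSolvedForm Q' ∧
      (Q' ≠ ConjQuery.Query.ff ∨ Q.card = 0 → ConjQuery.Equivalent.{u, v, w} Q Q') ∧
      (Q' = ConjQuery.Query.ff → ConjQuery.Unsolvable.{u, v, w} Q) ∧
      ConjQuery.FEAEquivalent.{u, v, w} Q Q') := by
  refine ⟨?_, ConjQuery.exists_output Q, fun Q' hQ' => ?_⟩
  · rintro ⟨run, -, h⟩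
    exact (wellFounded_iff_isEmpty_descending_chain.1 (ConjQuery.wellFounded_step (L := L))).false
      ⟨run, h⟩
  obtain ⟨hreach, hterm⟩ := hQ'
  have hsolved : ConjQuery.InSolvedForm Q' := by
    by_cases hff : Q' = ConjQuery.Query.ff
    · exact Or.inr (Or.inl hff)
    · exact ConjQuery.inSolvedForm_of_terminal hff (hterm.resolve_left hff)
  refine ⟨hsolved, ?_⟩
  rcases ConjQuery.solEquiv_or_of_reachable.{u, v, w} hreach with h | ⟨rfl, h⟩
  · refine ⟨fun _ => h.equivalent, ?_, h.feaEquivalent⟩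
    rintro rfl
    exact ConjQuery.Unsolvable.of_solEquiv_ff h
  · exact ⟨fun hQ => h.equivalent_ff (hQ.resolve_left (not_not_intro rfl)), fun _ => h,
      h.feaEquivalent_ff⟩
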